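/- Consider $n$ replicas, at most $f<n/3$ of which are faulty, communicating by authenticated point-to-point messages with unforgeable signatures. A *chained leader-speaks-once (CLSO) protocol* is a deterministic protocol of the following form. Each view $w$ has a designated leader $L_w$. On entering view $w$ (after voting in view $w-1$, or because of a timeout), a replica sends to $L_w$ a signed report of the votes it has cast (a vote response if it voted in view $w-1$, otherwise a new-view message). Having received reports for view $w$ from at least $n-f$ replicas, $L_w$ may multicast one signed block proposal, which contains the view, a pointer to a parent block, the pending batch of client transactions, one quorum certificate ($n-f$ signed votes) for an ancestor, and possibly reports received and equivocation proofs (two distinct blocks of the same view signed by the same leader). A replica votes at most once per view, only for valid proposals of its current view, and then moves to the next view. A replica that receives a proposal for its current view containing a valid equivocation proof slashes the convicted replica: it ignores all further messages from it. A replica that votes for a block may, by a deterministic rule depending only on that block and its chain, commit a block that is supported by two chained quorum certificates, together with all its ancestors; the views of the two certificates need not be consecutive. **Theorem.** For all $n,f$ with $f<n/3$, every leader schedule, every application-level validity predicate, every message delay bound $\Delta>0$ and every view-entry bound $T_f\ge 0$, there is a CLSO protocol such that, whenever at most $f$ replicas are faulty: 1. (Safety under asynchrony, Byzantine faults.) In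 every asynchronous execution, honest replicas never commit conflicting blocks (blocks neither of which extends the other), the batches they commit are valid, and they slash only replicas that deviate from the protocol. 2. Suppose that the network is partially synchronous: messages between honest replicas sent at time $t$ arrive by $\max(t,\mathrm{GST})+\Delta$, where GST is unknown. Let $v<v'<v''$ be views with honest leaders that are synchronized after GST (all honest replicas enter the view within $T_f$ of the first one, not before GST, and none of them times out of it before a fixed duration, a constant of the protocol, has elapsed). Then a block is proposed in view $v$, and for the block $B$ proposed in view $v$: either every honest replica has committed $B$ by the end of view $v''$, or there is a faulty replica that no honest replica had slashed before entering view $v$ and that every honest replica has slashed by the end of view $v''$ (and from then on excludes from participation). 3. (Gap-tolerance under omission faults.) If in the situation of 2 the faulty replicas only commit omission faults (they follow the protocol, except that messages to or from them may be lost and that they may stop), then every honest replica has committed $B$ by the end of view $v''$. -/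

import Mathlib

/-!
Chained leader-speaks-once (CLSO) protocols for `n` replicas, with ideal signatures and
collision-free hash pointers, their executions (asynchronous, Byzantine or omission-faulty), and
partial synchrony with view synchronization.
-/

namespace CLSO

/-! ### Blocks -/

/-- Blocks. A non-genesis block carries the view in which it is proposed, its parent (a hash
pointer is modelled by the parent itself), a batch of client transactions, one quorum certificate
(the certified block together with signed votes `(r, E)`: replica `r` signed a vote for `E`),
a list of signed reports sent to the leader for this view (`(r, l)`: on entering this view,
replica `r` reported the list `l` of votes it had cast; empty for a fast block), and
a list of claimed equivocation proofs. The signature of the leader of its view is implicit. -/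
inductive Block (n : ℕ) (Tx : Type*) : Type _
  | genesis : Block n Tx
  | node (view : ℕ) (parent : Block n Tx) (batch : Tx)
      (certified : Block n Tx) (votes : List (Fin n × Block n Tx))
      (reports : List (Fin n × List (Block n Tx)))
      (proofs : List (Block n Tx × Block n Tx)) : Block n Tx

variable {n f : ℕ} {Tx : Type*}

namespace Block

/-- The view in which a block was proposed (`0` for the genesis block). -/
def view : Block n Tx → ℕ
  | genesis => 0
  | node w _ _ _ _ _ _ => w

/-- The block certified by the quorum certificate that a block carries. -/
def certified : Block n Tx → Block n Tx
  | genesis => genesis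
  | node _ _ _ c _ _ _ => c

/-- The batch of client transactions of a non-genesis block. -/
def batch : Block n Tx → Option Tx
  | genesis => none
  | node _ _ b _ _ _ _ => some b

/-- The equivocation proofs carried by a block. -/
def proofs : Block n Tx → List (Block n Tx × Block n Tx)
  | genesis => []
  | node _ _ _ _ _ _ q => q

/-- `Ancestor A B`: the block `B` extends the block `A`; every block extends itself. -/
inductive Ancestor : Block n Tx → Block n Tx → Prop
  | refl (B : Block n Tx) : Ancestor B B
  | step {A P : Block n Tx} (w : ℕ) (b : Tx) (c : Block n Tx) (vs : List (Fin n × Block n Tx))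
      (rs : List (Fin n × List (Block n Tx))) (q : List (Block n Tx × Block n Tx)) :
      Ancestor A P → Ancestor A (node w P b c vs rs q)

/-- Two blocks conflict if neither extends the other. -/
def Conflict (A B : Block n Tx) : Prop := ¬ Ancestor A B ∧ ¬ Ancestor B A

/-- `votes` is a quorum certificate for `c`: at least `n - f` distinct replicas voted for `c` or
for a block extending `c`. The genesis block needs no votes. -/
def IsQC (f : ℕ) (c : Block n Tx) (votes : List (Fin n × Block n Tx)) : Prop :=
  c = genesis ∨
    ((∀ x ∈ votes, Ancestor c x.2) ∧ n - f ≤ (votes.map Prod.fst).toFinset.card)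

/-- Protocol-independent block validity: the parent is valid and from a lower view, the batch is
valid for the application, and the quorum certificate is one for an ancestor. -/
inductive Valid (f : ℕ) (ExVal : Tx → Prop) : Block n Tx → Prop
  | genesis : Valid f ExVal genesis
  | node (w : ℕ) (P : Block n Tx) (b : Tx) (c : Block n Tx) (vs : List (Fin n × Block n Tx))
      (rs : List (Fin n × List (Block n Tx))) (q : List (Block n Tx × Block n Tx)) :
      Valid f ExVal P → P.view < w → ExVal b → Ancestor c P → IsQC f c vs →
      Valid f ExVal (node w P b c vs rs q)

/-- `Part D B`: the block `D` is an immediate constituent of the block `B`. -/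
def Part (D : Block n Tx) : Block n Tx → Prop
  | genesis => False
  | node _ P _ c vs rs q =>
      D = P ∨ D = c ∨ (∃ x ∈ vs, D = x.2) ∨ (∃ x ∈ rs, D ∈ x.2) ∨
        (∃ x ∈ q, D = x.1 ∨ D = x.2)

open scoped Classical in
/-- The replicas convicted by the valid equivocation proofs in a block: two distinct proposals for
the same view, both signed by the leader of that view. -/
noncomputable def convicted (leader : ℕ → Fin n) (B : Block n Tx) : Finset (Fin n) :=
  Finset.univ.filter fun p =>
    ∃ x ∈ B.proofs, x.1 ≠ genesis ∧ x.2 ≠ genesis ∧ x.1 ≠ x.2 ∧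
      x.1.view = x.2.view ∧ leader x.1.view = p

end Block

/-! ### Local states, protocols -/

/-- The signed message that a replica sends to the leader of `view` when it enters that view. It
lists the votes the sender has cast, latest first. If the latest vote is for view `view - 1` it is
a VOTE-RESP for that block, otherwise it is a NEW-VIEW (recovery) message. -/
structure Report (n : ℕ) (Tx : Type*) where
  sender : Fin n
  view : ℕ
  record : List (Block n Tx)

/-- Local state of a replica. -/
structure LocalState (n : ℕ) (Tx : Type*) where
  /-- current view -/
  view : ℕ
  /-- blocks voted for, latest first -/
  votes : List (Block n Tx)
  /-- reports sent -/
  sent : List (Report n Tx)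
  /-- reports received -/
  inbox : List (Report n Tx)
  /-- whether the waiting timer of the current view has expired -/
  timer : Bool
  /-- blocks proposed (multicast in a VOTE-REQ to all replicas) -/
  proposed : List (Block n Tx)
  /-- replicas detected as faulty; all further messages from them are ignored -/
  slashed : Finset (Fin n)

/-- The initial state; views are entered from `1` on. -/
def LocalState.initial : LocalState n Tx := ⟨0, [], [], [], false, [], ∅⟩

/-- What a leader decides about its block; view and client batch are added to it. -/
structure Draft (n : ℕ) (Tx : Type*) where
  parent : Block n Tx
  certified : Block n Tx
  votes : List (Fin n × Block n Tx)
  reports : List (Fin n × List (Block n Tx))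
  proofs : List (Block n Tx × Block n Tx)

/-- A deterministic chained leader-speaks-once protocol. The message pattern is the same for all
of them (see `react`); a protocol consists of the local decisions. -/
structure Protocol (n f : ℕ) (Tx : Type*) where
  /-- the leader: whether to propose now, and what -/
  propose : Fin n → LocalState n Tx → Option (Draft n Tx)
  /-- the replica: whether to vote for a valid block proposed in the current view -/
  accept : Fin n → LocalState n Tx → Block n Tx → Prop
  /-- the commit rule: when a replica has voted for a block, the highest block of its chain (if
  any) that is thereby committed, together with all its ancestors -/
  commitRule : Block n Tx → Option (Block n Tx)
  /-- delay between entering a view and the expiration of the waiting timer -/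
  wait : ℝ
  /-- time for which a synchronized view has to last -/
  duration : ℝ
  wait_nonneg : 0 ≤ wait
  /-- a leader needs reports for its view from `n - f` distinct replicas -/
  quorum : ∀ r s d, propose r s = some d →
    n - f ≤ ((s.inbox.filter fun m => m.view = s.view).map Report.sender).toFinset.card
  /-- committing takes two chained quorum certificates (in views that may be non-consecutive) -/
  two_chain : ∀ B C, commitRule B = some C → Block.Ancestor C B.certified.certified

/-- Inputs of a replica: the pacemaker asks to move to view `w` (the view timed out); the waiting
timer of view `w` expires; a report arrives; the proposal of a block arrives. -/
inductive Input (n : ℕ) (Tx : Type*)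
  | advance (w : ℕ) : Input n Tx
  | timer (w : ℕ) : Input n Tx
  | report (m : Report n Tx) : Input n Tx
  | proposal (B : Block n Tx) : Input n Tx

/-- Replica `r` enters view `w` and sends its report to the leader of `w`. -/
def LocalState.enter (r : Fin n) (s : LocalState n Tx) (w : ℕ) : LocalState n Tx :=
  { s with view := w, timer := false, sent := ⟨r, w, s.votes⟩ :: s.sent }

namespace Protocol

variable (P : Protocol n f Tx) (leader : ℕ → Fin n) (ExVal : Tx → Prop)

open scoped Classical in
/-- Reaction to a proposal. Proposals for another view than the current one, and proposals by a
slashed leader, are ignored. The replica first slashes the leaders convicted by the block, then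
votes for the block if it is valid and accepted; by voting it moves to the next view. -/
noncomputable def onProposal (r : Fin n) (s : LocalState n Tx) (B : Block n Tx) :
    LocalState n Tx :=
  if B.view = s.view ∧ leader B.view ∉ s.slashed then
    let s' := { s with slashed := s.slashed ∪ B.convicted leader }
    if B.Valid f ExVal ∧ P.accept r s' B then
      LocalState.enter r { s' with votes := B :: s'.votes } (B.view + 1)
    else s'
  else s

open scoped Classical in
/-- State change caused by an input, before the replica acts as a leader. -/
noncomputable def onInput (r : Fin n) (s : LocalState n Tx) : Input n Tx → LocalState n Tx
  | .advance w => if s.view < w then s.enter r w else s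
  | .timer w => if s.view = w then { s with timer := true } else s
  | .report m => if m.sender ∉ s.slashed then { s with inbox := m :: s.inbox } else s
  | .proposal B => P.onProposal leader ExVal r s B

open scoped Classical in
/-- The leader of the current view proposes at most one block in it, containing the batch `b`. -/
noncomputable def tryPropose (r : Fin n) (b : Tx) (s : LocalState n Tx) : LocalState n Tx :=
  if leader s.view = r ∧ ∀ B ∈ s.proposed, B.view ≠ s.view then
    match P.propose r s with
    | none => s
    | some d =>
      { s with proposed :=
          .node s.view d.parent b d.certified d.votes d.reports d.proofs :: s.proposed }
  else s

/-- The complete reaction of a replica that follows the protocol; `batch w` is the batch of client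
requests that is pending at the leader of view `w`. -/
noncomputable def react (batch : ℕ → Tx) (r : Fin n) (s : LocalState n Tx) (a : Input n Tx) :
    LocalState n Tx :=
  let s' := P.onInput leader ExVal r s a
  P.tryPropose leader r (batch s'.view) s'

/-- The replica has committed the block `B`. -/
def Committed (s : LocalState n Tx) (B : Block n Tx) : Prop :=
  ∃ D ∈ s.votes, ∃ C, P.commitRule D = some C ∧ Block.Ancestor B C

end Protocol

/-! ### Signatures -/

/-- Ideal signatures: all signatures contained in `B`, at any depth, that are attributed to
replicas in `F` were produced by them (`F` are the replicas that follow the protocol, `σ` their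
present states). -/
def Authentic (leader : ℕ → Fin n) (F : Finset (Fin n)) (σ : Fin n → LocalState n Tx)
    (B : Block n Tx) : Prop :=
  ∀ D, Relation.ReflTransGen Block.Part D B →
    match D with
    | .genesis => True
    | .node w P b c vs rs q =>
        (leader w ∈ F → Block.node w P b c vs rs q ∈ (σ (leader w)).proposed) ∧
        (∀ x ∈ vs, x.1 ∈ F → x.2 ∈ (σ x.1).votes) ∧
        (∀ x ∈ rs, x.1 ∈ F → (⟨x.1, w, x.2⟩ : Report n Tx) ∈ (σ x.1).sent)

/-- All signatures in an input are genuine. -/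
def Genuine (leader : ℕ → Fin n) (F : Finset (Fin n)) (σ : Fin n → LocalState n Tx) :
    Input n Tx → Prop
  | .advance _ => True
  | .timer _ => True
  | .report m => (m.sender ∈ F → m ∈ (σ m.sender).sent) ∧
      ∀ B ∈ m.record, Authentic leader F σ B
  | .proposal B => Authentic leader F σ B

/-! ### Executions -/

/-- An asynchronous execution: in step `i`, at time `time i`, replica `actor i` gets `input i`.
The adversary schedules all inputs and may deliver to anyone any message, at any time and any
number of times, or never; a message with a forged signature is ignored. At most `f` replicas are
not honest. Replicas in `follows` run the protocol: the honest ones, and those faulty ones that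
only suffer omissions (of sending or receiving, or a crash); the other replicas are Byzantine. -/
structure Execution (P : Protocol n f Tx) (leader : ℕ → Fin n) (ExVal : Tx → Prop) where
  honest : Finset (Fin n)
  follows : Finset (Fin n)
  honest_subset : honest ⊆ follows
  faulty_card : honestᶜ.card ≤ f
  batch : ℕ → Tx
  batch_valid : ∀ w, ExVal (batch w)
  actor : ℕ → Fin n
  input : ℕ → Input n Tx
  time : ℕ → ℝ
  time_mono : Monotone time
  state : ℕ → Fin n → LocalState n Tx
  state_zero : ∀ r, state 0 r = LocalState.initial
  state_step : ∀ i, ∀ r ∈ follows,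
    (actor i = r → Genuine leader follows (state i) (input i) →
      state (i + 1) r = P.react leader ExVal batch r (state i r) (input i)) ∧
    (¬ (actor i = r ∧ Genuine leader follows (state i) (input i)) →
      state (i + 1) r = state i r)

namespace Execution

variable {P : Protocol n f Tx} {leader : ℕ → Fin n} {ExVal : Tx → Prop}
variable (E : Execution P leader ExVal)

/-- All failures are omission failures. -/
def OmissionOnly : Prop := E.follows = Finset.univ

/-- Replica `r` enters view `w` in step `i`. -/
def Enters (i : ℕ) (r : Fin n) (w : ℕ) : Prop :=
  (E.state i r).view < w ∧ (E.state (i + 1) r).view = w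

/-- Partial synchrony: a message between honest replicas sent at time `t` arrives by time
`max t GST + Δ`, and the waiting timers of honest replicas expire on time. -/
structure PartiallySynchronous (GST Δ : ℝ) : Prop where
  report : ∀ i, ∀ r ∈ E.honest, ∀ m, m ∉ (E.state i r).sent → m ∈ (E.state (i + 1) r).sent →
    leader m.view ∈ E.honest →
    ∃ j, i < j ∧ E.actor j = leader m.view ∧ E.input j = .report m ∧
      E.time j ≤ max (E.time i) GST + Δ
  proposal : ∀ i, ∀ r ∈ E.honest, ∀ B, B ∉ (E.state i r).proposed →
    B ∈ (E.state (i + 1) r).proposed → ∀ q ∈ E.honest,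
    ∃ j, i < j ∧ E.actor j = q ∧ E.input j = .proposal B ∧
      E.time j ≤ max (E.time i) GST + Δ
  timer_fires : ∀ i, ∀ r ∈ E.honest, ∀ w, E.Enters i r w →
    ∃ j, i < j ∧ E.actor j = r ∧ E.input j = .timer w ∧ E.time j = E.time i + P.wait
  timer_accurate : ∀ i, ∀ r ∈ E.honest, ∀ w, E.Enters i r w →
    ∀ j, E.actor j = r → E.input j = .timer w → E.time i + P.wait ≤ E.time j

/-- View `w` is synchronized after `GST`: all honest replicas enter it within time `Tf` from when
the first one does, and the pacemaker makes none of them leave it before its duration is over (a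
replica may still move on by voting in it). -/
def Synchronized (GST Tf : ℝ) (w : ℕ) : Prop :=
  ∃ t₀, GST ≤ t₀ ∧
    (∀ r ∈ E.honest, ∃ i, E.Enters i r w ∧ t₀ ≤ E.time i ∧ E.time i ≤ t₀ + Tf) ∧
    (∀ r ∈ E.honest, ∀ j w', E.actor j = r → (E.state j r).view = w →
      E.input j = .advance w' → w < w' → t₀ + P.duration < E.time j)

/-- `B` is proposed by the leader of view `w` in view `w`. -/
def Proposed (w : ℕ) (B : Block n Tx) : Prop :=
  B.view = w ∧ ∃ i, B ∈ (E.state i (leader w)).proposed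

/-- Every honest replica has committed `B` by the end of view `w`. -/
def CommittedBy (w : ℕ) (B : Block n Tx) : Prop :=
  ∀ r ∈ E.honest, ∃ i, (E.state i r).view ≤ w ∧ P.Committed (E.state (i + 1) r) B

/-- The replica `p` is undetected before view `w`, and detected and slashed by all honest replicas
by the end of view `w'`. -/
def NewlySlashed (w w' : ℕ) (p : Fin n) : Prop :=
  (∀ r ∈ E.honest, ∀ i, (E.state i r).view < w → p ∉ (E.state i r).slashed) ∧
  (∀ r ∈ E.honest, ∃ i, (E.state i r).view ≤ w' ∧ p ∈ (E.state (i + 1) r).slashed)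

/-- `v < v' < v''` are views with honest leaders, synchronized after `GST`. -/
structure HonestTriple (GST Tf : ℝ) (v v' v'' : ℕ) : Prop where
  lt₁ : v < v'
  lt₂ : v' < v''
  honest₁ : leader v ∈ E.honest
  honest₂ : leader v' ∈ E.honest
  honest₃ : leader v'' ∈ E.honest
  sync₁ : E.Synchronized GST Tf v
  sync₂ : E.Synchronized GST Tf v'
  sync₃ : E.Synchronized GST Tf v''

end Execution

/-! ### Properties of protocols -/

namespace Protocol

variable (P : Protocol n f Tx) (leader : ℕ → Fin n) (ExVal : Tx → Prop)

/-- Safety under asynchrony: honest replicas never commit conflicting blocks. -/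
def Safe : Prop :=
  ∀ E : Execution P leader ExVal, ∀ r ∈ E.honest, ∀ r' ∈ E.honest, ∀ i j B B',
    P.Committed (E.state i r) B → P.Committed (E.state j r') B' → ¬ Block.Conflict B B'

/-- External validity: batches committed by honest replicas are valid. -/
def ExternallyValid : Prop :=
  ∀ E : Execution P leader ExVal, ∀ r ∈ E.honest, ∀ i B b,
    P.Committed (E.state i r) B → B.batch = some b → ExVal b

/-- Honest replicas slash only replicas that deviate from the protocol. -/
def SlashesOnlyDeviating : Prop :=
  ∀ E : Execution P leader ExVal, ∀ r ∈ E.honest, ∀ i,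
    ∀ p ∈ (E.state i r).slashed, p ∉ E.follows

/-- In synchronized views `v < v' < v''` with honest leaders, a block with the pending client
batch is proposed in view `v`, and it is committed by view `v''` or a previously undetected faulty replica is slashed. -/
def CommitsOrSlashes (Δ Tf : ℝ) : Prop :=
  ∀ (E : Execution P leader ExVal) (GST : ℝ), E.PartiallySynchronous GST Δ →
    ∀ v v' v'', E.HonestTriple GST Tf v v' v'' →
      (∃ B, E.Proposed v B ∧ B.batch = some (E.batch v)) ∧
      ∀ B, E.Proposed v B →
        E.CommittedBy v'' B ∨ ∃ p, p ∉ E.honest ∧ E.NewlySlashed v v'' p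

/-- Gap-tolerance under omission failures: in that case the block is committed. -/
def OmissionGapTolerant (Δ Tf : ℝ) : Prop :=
  ∀ (E : Execution P leader ExVal) (GST : ℝ), E.OmissionOnly → E.PartiallySynchronous GST Δ →
    ∀ v v' v'', E.HonestTriple GST Tf v v' v'' →
      (∃ B, E.Proposed v B ∧ B.batch = some (E.batch v)) ∧ ∀ B, E.Proposed v B → E.CommittedBy v'' B

end Protocol

end CLSO

namespace CLSO

variable {n f : ℕ} {Tx : Type*}

/-! Replicas keep no lock of their own; all evidence lies in the blocks. A report is the full voting
record, so a replica that follows the protocol tells the same about earlier views in every report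
for a given view (`Signed.mem_report`). A sound block carries a quorum of reports, and its parent is
a reported vote (or genesis) of maximal view, ties being broken by the highest view locked. A block
locks `k` if its reports show a quorum of votes for `k` and, from the view of `k` on, only votes
that extend `k`.

Safety. Locks held by equivocating blocks of one view are compatible: the quorum behind the higher
locked block meets the reporters of the other block in a replica that follows the protocol, so the
higher one is reported there too and must extend the lower (`ancestor_of_locks`). Now let a quorum
vote for `B`, which locks `k`. The reports in any later block include a vote for `B`, so its parent
is at least as preferred as `B`. A parent of a higher view extends `k` by induction; one of the same
view has at least as high a lock and extends `k` by compatibility (`ancestor_of_locks_of_view_lt`).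
A commit requires such a `B`, so committed blocks lie on one chain.

Liveness. In a synchronized view with an honest leader, the leader hears all honest replicas and all
of them vote for its only block (`exists_goodView`), which all later blocks then extend
(`GoodView.ancestor`). Hence the second such block locks the first, the third reports a quorum for
the second, and choosing the highest certificate yields the two chained certificates
(`committedBy_of_honestTriple`). Equivocation by faulty leaders cannot prevent this, so the commit
alternative always holds; slashing only has to be harmless. -/

theorem exists_forall_le_of_bounded {α : Type*} {p : α → Prop} (g : α → ℕ) (N : ℕ)
    (hN : ∀ a, p a → g a ≤ N) (h : ∃ a, p a) : ∃ a, p a ∧ ∀ b, p b → g b ≤ g a := by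
  obtain ⟨a, ha, hmin⟩ := (measure fun a => N - g a).wf.has_min {a | p a} h
  refine ⟨a, ha, fun b hb => ?_⟩
  have h1 : ¬ (N - g b < N - g a) := hmin b hb
  have h2 := hN a ha
  have h3 := hN b hb
  omega

/-- Two quorums and the complement of a set of at most `f` replicas have a common member. -/
theorem exists_mem_quorums (hf : 3 * f < n) {A B F : Finset (Fin n)} (hA : n - f ≤ A.card)
    (hB : n - f ≤ B.card) (hF : Fᶜ.card ≤ f) : ∃ r ∈ F, r ∈ A ∧ r ∈ B := by
  by_contra! hcon
  have hsub : A ∩ B ⊆ Fᶜ := by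
    intro r hr
    rw [Finset.mem_inter] at hr
    rw [Finset.mem_compl]
    exact fun h => hcon r h hr.1 hr.2
  have h1 := Finset.card_le_card hsub
  have h2 := Finset.card_union_add_card_inter A B
  have h3 : (A ∪ B).card ≤ n := by simpa using Finset.card_le_univ (A ∪ B)
  -- The intersection has at least `2 * (n - f) - n = n - 2 * f` members, which exceeds `f`.
  omega

namespace Block

/-- The reports carried by a block. -/
def reports : Block n Tx → List (Fin n × List (Block n Tx))
  | genesis => []
  | node _ _ _ _ _ rs _ => rs

/-- The votes in the quorum certificate carried by a block. -/
def qcVotes : Block n Tx → List (Fin n × Block n Tx)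
  | genesis => []
  | node _ _ _ _ vs _ _ => vs

/-! ### Ancestors -/

theorem genesis_ancestor : ∀ B : Block n Tx, Ancestor genesis B
  | genesis => .refl _
  | node w P b c vs rs q => .step w b c vs rs q (genesis_ancestor P)

theorem Ancestor.trans {A B C : Block n Tx} (h : Ancestor A B) (h' : Ancestor B C) :
    Ancestor A C := by
  induction h' with
  | refl => exact h
  | step w b c vs rs q _ ih => exact .step w b c vs rs q ih

/-- Each block has a single parent, so the ancestors of a block form a chain. -/
theorem Ancestor.total {A B C : Block n Tx} (hA : Ancestor A C) (hB : Ancestor B C) :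
    Ancestor A B ∨ Ancestor B A := by
  induction hA with
  | refl => exact .inr hB
  | step w b c vs rs q h ih =>
    cases hB with
    | refl => exact .inl (.step w b c vs rs q h)
    | step _ _ _ _ _ _ h' => exact ih h'

theorem part_parent (w : ℕ) (P : Block n Tx) (b : Tx) (c : Block n Tx)
    (vs : List (Fin n × Block n Tx)) (rs : List (Fin n × List (Block n Tx)))
    (q : List (Block n Tx × Block n Tx)) : Part P (node w P b c vs rs q) := .inl rfl

theorem Ancestor.parts {A B : Block n Tx} (h : Ancestor A B) :
    Relation.ReflTransGen Part A B := by
  induction h with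
  | refl => exact .refl
  | step w b c vs rs q _ ih => exact ih.tail (part_parent ..)

theorem parts_certified : ∀ B : Block n Tx, Relation.ReflTransGen Part B.certified B
  | genesis => .refl
  | node _ _ _ _ _ _ _ => .single (.inr (.inl rfl))

theorem part_of_mem_reports : ∀ {B X : Block n Tx} {x : Fin n × List (Block n Tx)},
    x ∈ B.reports → X ∈ x.2 → Part X B
  | genesis, _, _, hx, _ => by simp [reports] at hx
  | node _ _ _ _ _ _ _, _, x, hx, hX => .inr (.inr (.inr (.inl ⟨x, hx, hX⟩)))

/-! ### Locks and admissible blocks -/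

open scoped Classical in
/-- The replicas that reported a vote for `B`. -/
noncomputable def voters (rs : List (Fin n × List (Block n Tx))) (B : Block n Tx) :
    Finset (Fin n) :=
  Finset.univ.filter fun r => ∃ x ∈ rs, x.1 = r ∧ B ∈ x.2

theorem mem_voters {rs : List (Fin n × List (Block n Tx))} {B : Block n Tx} {r : Fin n} :
    r ∈ voters rs B ↔ ∃ x ∈ rs, x.1 = r ∧ B ∈ x.2 := by
  simp [voters]

/-- The reports in `B` contain a quorum of votes for `k`, and no vote from the view of `k` on for
a block that does not extend `k`. -/
def Locks (f : ℕ) (B k : Block n Tx) : Prop :=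
  n - f ≤ (voters B.reports k).card ∧
    ∀ x ∈ B.reports, ∀ X ∈ x.2, k.view ≤ X.view → Ancestor k X

open scoped Classical in
/-- The highest view of a block that is locked by `B`. -/
noncomputable def lockView (f : ℕ) (B : Block n Tx) : ℕ :=
  Nat.findGreatest (fun m => ∃ k, Locks f B k ∧ k.view = m) B.view

theorem Locks.le_lockView {B k : Block n Tx} (h : Locks f B k) (hk : k.view ≤ B.view) :
    k.view ≤ lockView f B := by
  classical
  exact Nat.le_findGreatest hk ⟨k, h, rfl⟩

/-- Positivity matters: `0` is also the default value of `Nat.findGreatest` when nothing is locked.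
-/
theorem exists_locks_of_lockView_pos {B : Block n Tx} (h : 0 < lockView f B) :
    ∃ k, Locks f B k ∧ k.view = lockView f B := by
  classical
  exact Nat.findGreatest_of_ne_zero (P := fun m => ∃ k, Locks f B k ∧ k.view = m) rfl h.ne'

/-- The order in which voted blocks are preferred as parents. -/
def Precedes (f : ℕ) (A B : Block n Tx) : Prop :=
  A.view < B.view ∨ A.view = B.view ∧ lockView f A ≤ lockView f B

theorem Precedes.view_le {A B : Block n Tx} (h : Precedes f A B) : A.view ≤ B.view := by
  rcases h with h | h
  · exact h.le
  · exact h.1.le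

/-- `Precedes` is a total preorder, lexicographic in the view and the locked view. -/
theorem exists_max_precedes (l : List (Block n Tx)) (hl : l ≠ []) :
    ∃ P ∈ l, ∀ X ∈ l, Precedes f X P := by
  induction l with
  | nil => exact absurd rfl hl
  | cons a l ih =>
    have refl : ∀ X : Block n Tx, Precedes f X X := fun X => .inr ⟨rfl, le_rfl⟩
    by_cases h : l = []
    · subst h
      exact ⟨a, by simp, by simpa using refl a⟩
    · obtain ⟨P, hP, hmax⟩ := ih h
      by_cases ha : Precedes f a P
      · refine ⟨P, by simp [hP], fun X hX => ?_⟩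
        rcases List.mem_cons.1 hX with rfl | hX
        · exact ha
        · exact hmax X hX
      · refine ⟨a, by simp, fun X hX => ?_⟩
        rcases List.mem_cons.1 hX with rfl | hX
        · exact refl _
        · have := hmax X hX
          unfold Precedes at *
          omega

/-- The condition on a single block: it extends a most preferred reported vote, and its quorum certificate is not older than that of its parent. -/
def Admissible (f : ℕ) (ExVal : Tx → Prop) : Block n Tx → Prop
  | genesis => True
  | node w P b c vs rs _ =>
      P.view < w ∧ ExVal b ∧ Ancestor c P ∧ IsQC f c vs ∧ P.certified.view ≤ c.view ∧
        n - f ≤ (rs.map Prod.fst).toFinset.card ∧ (P = genesis ∨ ∃ x ∈ rs, P ∈ x.2) ∧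
        ∀ x ∈ rs, ∀ X ∈ x.2, Precedes f X P

/-- All blocks contained in `B`, at any depth, are admissible. -/
def Sound (f : ℕ) (ExVal : Tx → Prop) (B : Block n Tx) : Prop :=
  ∀ D, Relation.ReflTransGen Part D B → Admissible f ExVal D

variable {ExVal : Tx → Prop}

/-! ### Consequences of soundness -/

theorem Sound.admissible {B : Block n Tx} (h : Sound f ExVal B) : Admissible f ExVal B :=
  h B .refl

theorem Sound.of_parts {D B : Block n Tx} (h : Sound f ExVal B)
    (hD : Relation.ReflTransGen Part D B) : Sound f ExVal D :=
  fun C hC => h C (hC.trans hD)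

theorem sound_of_part {B : Block n Tx} (h : Admissible f ExVal B)
    (h' : ∀ D, Part D B → Sound f ExVal D) : Sound f ExVal B := by
  intro D hD
  rcases hD.cases_tail with rfl | ⟨C, hDC, hC⟩
  · exact h
  · exact h' C hC D hDC

theorem sound_genesis : Sound f ExVal (genesis : Block n Tx) :=
  sound_of_part trivial fun _ h => h.elim

theorem Sound.eq_genesis {B : Block n Tx} (h : Sound f ExVal B) (hB : B.view = 0) :
    B = genesis := by
  cases B with
  | genesis => rfl
  | node w P b c vs rs q =>
    have := h.admissible.1
    simp only [view] at hB
    omega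

theorem Sound.eq_or_view_lt {A B : Block n Tx} (h : Sound f ExVal B) (hA : Ancestor A B) :
    A = B ∨ A.view < B.view := by
  induction hA with
  | refl => exact .inl rfl
  | step w b c vs rs q _ ih =>
    right
    have h1 := h.admissible.1
    rcases ih (h.of_parts (.single (part_parent ..))) with rfl | h2
    · exact h1
    · exact h2.trans h1

theorem Sound.view_le {A B : Block n Tx} (h : Sound f ExVal B) (hA : Ancestor A B) :
    A.view ≤ B.view := by
  rcases h.eq_or_view_lt hA with rfl | h
  · exact le_rfl
  · exact h.le

theorem Sound.ancestor_of_view_le {A B C : Block n Tx} (h : Sound f ExVal C)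
    (hA : Ancestor A C) (hB : Ancestor B C) (hAB : A.view ≤ B.view) : Ancestor A B := by
  rcases hA.total hB with h' | h'
  · exact h'
  · rcases (h.of_parts hA.parts).eq_or_view_lt h' with rfl | h''
    · exact h'
    · omega

/-- Admissibility forbids a certificate older than that of the parent. This bounds from below the
second of two chained certificates when the first is not for the expected block but for a descendant
of it. -/
theorem Sound.certified_view_mono {A B : Block n Tx} (h : Sound f ExVal B)
    (hA : Ancestor A B) : A.certified.view ≤ B.certified.view := by
  induction hA with
  | refl => exact le_rfl
  | step w b c vs rs q _ ih =>
    exact (ih (h.of_parts (.single (part_parent ..)))).trans h.admissible.2.2.2.2.1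

theorem Sound.valid : ∀ {B : Block n Tx}, Sound f ExVal B → Valid f ExVal B
  | genesis, _ => .genesis
  | node w P b c vs rs q, h =>
    .node w P b c vs rs q (Sound.valid (h.of_parts (.single (part_parent ..))))
      h.admissible.1 h.admissible.2.1 h.admissible.2.2.1 h.admissible.2.2.2.1

theorem Sound.quorum {B : Block n Tx} (h : Sound f ExVal B) (hB : B ≠ genesis) :
    n - f ≤ (B.reports.map Prod.fst).toFinset.card := by
  cases B with
  | genesis => exact absurd rfl hB
  | node w P b c vs rs q => exact h.admissible.2.2.2.2.2.1

/-- The parent of a sound block is sound and preferred to all reported votes. -/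
theorem Sound.exists_parent {B : Block n Tx} (h : Sound f ExVal B) (hB : B ≠ genesis) :
    ∃ P, Part P B ∧ Ancestor P B ∧ P.view < B.view ∧
      (P = genesis ∨ ∃ x ∈ B.reports, P ∈ x.2) ∧
      ∀ x ∈ B.reports, ∀ X ∈ x.2, Precedes f X P := by
  cases B with
  | genesis => exact absurd rfl hB
  | node w P b c vs rs q =>
    exact ⟨P, part_parent .., .step _ _ _ _ _ _ (.refl P), h.admissible.1,
      h.admissible.2.2.2.2.2.2⟩

/-- A quorum is nonempty because `f < n`, so `k` really occurs in a report and inherits soundness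
and authenticity from `B`. -/
theorem parts_of_mem_voters (hf : 3 * f < n) {B k : Block n Tx}
    (h : n - f ≤ (voters B.reports k).card) : Part k B := by
  obtain ⟨r, hr⟩ := Finset.card_pos.1 (show 0 < (voters B.reports k).card by omega)
  obtain ⟨x, hx, -, hX⟩ := mem_voters.1 hr
  exact part_of_mem_reports hx hX

/-- A sound block extends the blocks that it locks. -/
theorem Locks.ancestor (hf : 3 * f < n) {B k : Block n Tx} (h : Locks f B k)
    (hB : Sound f ExVal B) : Ancestor k B := by
  have hk : Sound f ExVal k := hB.of_parts (.single (parts_of_mem_voters hf h.1))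
  obtain ⟨r, hr⟩ := Finset.card_pos.1 (show 0 < (voters B.reports k).card by
    have := h.1
    omega)
  obtain ⟨x, hx, -, hX⟩ := mem_voters.1 hr
  have hne : B ≠ genesis := by
    rintro rfl
    simp [reports] at hx
  obtain ⟨P, -, hPB, -, hP, hmax⟩ := hB.exists_parent hne
  have hle := (hmax x hx k hX).view_le
  rcases hP with rfl | ⟨y, hy, hPy⟩
  · rw [hk.eq_genesis (Nat.le_zero.1 hle)]
    exact genesis_ancestor B
  · exact (h.2 y hy P hPy hle).trans hPB

end Block

/-! ### The protocol -/

open Block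

open scoped Classical in
/-- The usable reports for the current view. -/
noncomputable def goodReports (f : ℕ) (ExVal : Tx → Prop) (s : LocalState n Tx) :
    List (Fin n × List (Block n Tx)) :=
  (s.inbox.filter fun m => m.view = s.view ∧
    ∀ X ∈ m.record, Sound f ExVal X ∧ X.view < s.view).map fun m => (m.sender, m.record)

open scoped Classical in
/-- Pairs of distinct blocks of the same view among the reported votes. -/
noncomputable def equivocations (rs : List (Fin n × List (Block n Tx))) :
    List (Block n Tx × Block n Tx) :=
  ((rs.flatMap Prod.snd) ×ˢ (rs.flatMap Prod.snd)).filter fun x =>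
    x.1 ≠ x.2 ∧ x.1.view = x.2.view

/-- The drafts between which a leader may choose. -/
structure Draft.Proper (f : ℕ) (ExVal : Tx → Prop) (s : LocalState n Tx) (d : Draft n Tx) :
    Prop where
  reports_eq : d.reports = goodReports f ExVal s
  proofs_eq : d.proofs = equivocations d.reports
  parent_mem : d.parent = genesis ∨ ∃ x ∈ d.reports, d.parent ∈ x.2
  parent_view : d.parent.view < s.view
  precedes : ∀ x ∈ d.reports, ∀ X ∈ x.2, Precedes f X d.parent
  quorum : n - f ≤ (d.reports.map Prod.fst).toFinset.card
  ancestor : Ancestor d.certified d.parent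
  isQC : IsQC f d.certified d.votes
  certified_view : d.parent.certified.view ≤ d.certified.view
  votes_mem : (∀ x ∈ d.votes, ∃ y ∈ d.reports, x.1 = y.1 ∧ x.2 ∈ y.2) ∨
    d.votes = d.parent.qcVotes

/-- A proper draft with a quorum certificate of the highest possible view. -/
def Draft.Best (f : ℕ) (ExVal : Tx → Prop) (s : LocalState n Tx) (d : Draft n Tx) : Prop :=
  d.Proper f ExVal s ∧ ∀ d' : Draft n Tx, d'.Proper f ExVal s →
    d'.certified.view ≤ d.certified.view

/-- Voting for `D` may commit `k`: the certificate in `D` is for a block with a certificate for a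
block extending `k`, and the reports in `D` contain a quorum of votes for a block locking `k`. -/
def Committable (f : ℕ) (D k : Block n Tx) : Prop :=
  Ancestor k D.certified.certified ∧
    ∃ B, n - f ≤ (voters D.reports B).card ∧ Locks f B k

open scoped Classical in
/-- The protocol: the leader waits for its timer, and then proposes a best draft. With locks, a
block proposed in a synchronized view of an honest leader is committed whether or not faulty
leaders equivocate; equivocation proofs are sent along to exclude them. -/
noncomputable def protocol (n f : ℕ) (ExVal : Tx → Prop) (Δ Tf : ℝ) (hΔ : 0 < Δ)
    (hTf : 0 ≤ Tf) : Protocol n f Tx where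
  propose _ s :=
    if h : s.timer = true ∧ ∃ d : Draft n Tx, d.Best f ExVal s then some h.2.choose else none
  accept _ _ B := B ≠ genesis ∧ Sound f ExVal B
  commitRule D :=
    if h : ∃ k, Committable f D k ∧ ∀ k', Committable f D k' → k'.view ≤ k.view then
      some h.choose else none
  -- Honest reports arrive within `Tf + Δ` of the first honest entry; the extra `1` makes them
  -- strictly earlier than the leader's timer, which orders the steps. The duration adds up the
  -- latest entry of the leader, its waiting time and the delivery of its proposal.
  wait := Tf + Δ + 1
  duration := Tf + (Tf + Δ + 1) + Δ
  wait_nonneg := by positivity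
  quorum r s d h := by
    split_ifs at h with hs
    have hd := hs.2.choose_spec.1
    refine hd.quorum.trans (Finset.card_le_card ?_)
    rw [hd.reports_eq]
    intro p hp
    simp only [goodReports, List.map_map, List.mem_toFinset, List.mem_map, List.mem_filter,
      Function.comp_apply] at hp ⊢
    obtain ⟨m, ⟨hm, hm'⟩, rfl⟩ := hp
    exact ⟨m, ⟨hm, by simpa using (of_decide_eq_true hm').1⟩, rfl⟩
  two_chain B C h := by
    split_ifs at h with hs
    rw [Option.some.injEq] at h
    exact h ▸ hs.choose_spec.1.1

/-! ### Drafts, proposals and the commit rule -/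

section Protocol

variable {ExVal : Tx → Prop} {Δ Tf : ℝ} {hΔ : 0 < Δ} {hTf : 0 ≤ Tf}

theorem protocol_propose_eq_some {r : Fin n} {s : LocalState n Tx} {d : Draft n Tx}
    (h : (protocol n f ExVal Δ Tf hΔ hTf).propose r s = some d) :
    s.timer = true ∧ d.Best f ExVal s := by
  simp only [protocol] at h
  split_ifs at h with hs
  rw [Option.some.injEq] at h
  exact ⟨hs.1, h ▸ hs.2.choose_spec⟩

theorem protocol_propose_isSome {r : Fin n} {s : LocalState n Tx} (ht : s.timer = true)
    (h : ∃ d : Draft n Tx, d.Best f ExVal s) :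
    ∃ d, (protocol n f ExVal Δ Tf hΔ hTf).propose r s = some d := by
  simp only [protocol]
  rw [dif_pos ⟨ht, h⟩]
  exact ⟨_, rfl⟩

theorem protocol_commitRule_eq_some {D k : Block n Tx}
    (h : (protocol n f ExVal Δ Tf hΔ hTf).commitRule D = some k) : Committable f D k := by
  simp only [protocol] at h
  split_ifs at h with hs
  rw [Option.some.injEq] at h
  exact h ▸ hs.choose_spec.1

/-- All committable blocks are ancestors of `D.certified.certified`, hence form a chain, and the one
of highest view extends all others. -/
theorem exists_protocol_commitRule {D k : Block n Tx} (hD : Sound f ExVal D)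
    (hk : Committable f D k) :
    ∃ k', (protocol n f ExVal Δ Tf hΔ hTf).commitRule D = some k' ∧ Ancestor k k' := by
  have hS : Sound f ExVal D.certified.certified :=
    hD.of_parts ((parts_certified _).trans (parts_certified _))
  have hs := exists_forall_le_of_bounded (p := Committable f D) Block.view
    D.certified.certified.view (fun a ha => hS.view_le ha.1) ⟨k, hk⟩
  refine ⟨hs.choose, ?_, ?_⟩
  · simp only [protocol]
    rw [dif_pos hs]
  · exact hS.ancestor_of_view_le hk.1 hs.choose_spec.1.1 (hs.choose_spec.2 k hk)

theorem mem_goodReports {s : LocalState n Tx} {x : Fin n × List (Block n Tx)} :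
    x ∈ goodReports f ExVal s ↔ (∃ m ∈ s.inbox, m.view = s.view ∧ x = (m.sender, m.record)) ∧
      ∀ X ∈ x.2, Sound f ExVal X ∧ X.view < s.view := by
  simp only [goodReports, List.mem_map, List.mem_filter, decide_eq_true_eq]
  constructor
  · rintro ⟨m, ⟨hm, hv, hX⟩, rfl⟩
    exact ⟨⟨m, hm, hv, rfl⟩, hX⟩
  · rintro ⟨⟨m, hm, hv, rfl⟩, hX⟩
    exact ⟨m, ⟨hm, hv, hX⟩, rfl⟩

theorem mem_equivocations {rs : List (Fin n × List (Block n Tx))} {y : Block n Tx × Block n Tx}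
    (h : y ∈ equivocations rs) : (∃ x ∈ rs, y.1 ∈ x.2) ∧ ∃ x ∈ rs, y.2 ∈ x.2 := by
  obtain ⟨A, B⟩ := y
  have h' := List.pair_mem_product.1 (List.mem_of_mem_filter h)
  exact ⟨List.mem_flatMap.1 h'.1, List.mem_flatMap.1 h'.2⟩

/-- A leader with reports from a quorum has a best draft. -/
theorem exists_best {s : LocalState n Tx} (hs : 0 < s.view)
    (hq : n - f ≤ ((goodReports f ExVal s).map Prod.fst).toFinset.card) :
    ∃ d : Draft n Tx, d.Best f ExVal s := by
  set rs := goodReports f ExVal s with hrs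
  have hP : ∃ P : Block n Tx, (P = genesis ∨ ∃ x ∈ rs, P ∈ x.2) ∧
      ∀ x ∈ rs, ∀ X ∈ x.2, Precedes f X P := by
    by_cases h : rs.flatMap Prod.snd = []
    · refine ⟨genesis, .inl rfl, fun x hx X hX => ?_⟩
      have : X ∈ rs.flatMap Prod.snd := List.mem_flatMap.2 ⟨x, hx, hX⟩
      simp [h] at this
    · obtain ⟨P, hP, hmax⟩ := exists_max_precedes (f := f) _ h
      exact ⟨P, .inr (List.mem_flatMap.1 hP),
        fun x hx X hX => hmax X (List.mem_flatMap.2 ⟨x, hx, hX⟩)⟩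
  obtain ⟨P, hPm, hmax⟩ := hP
  have hsound : Sound f ExVal P ∧ P.view < s.view := by
    rcases hPm with rfl | ⟨x, hx, hX⟩
    · exact ⟨sound_genesis, hs⟩
    · exact (mem_goodReports.1 hx).2 P hX
  -- Reusing the certificate of the parent always gives a proper draft; certificate views are
  -- bounded because a certified block is an ancestor of a parent from an earlier view.
  refine exists_forall_le_of_bounded (fun d : Draft n Tx => d.certified.view) s.view ?_
    ⟨⟨P, P.certified, P.qcVotes, rs, equivocations rs⟩, rfl, rfl, hPm, hsound.2, hmax, hq,
      ?_, ?_, le_rfl, .inr rfl⟩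
  · intro d hd
    have hdS : Sound f ExVal d.parent := by
      rcases hd.parent_mem with h | ⟨x, hx, hX⟩
      · exact h ▸ sound_genesis
      · exact ((mem_goodReports.1 (hd.reports_eq ▸ hx)).2 _ hX).1
    exact (hdS.view_le hd.ancestor).trans hd.parent_view.le
  · cases P with
    | genesis => exact .refl _
    | node w P b c vs rs q => exact .step _ _ _ _ _ _ hsound.1.admissible.2.2.1
  · cases P with
    | genesis => exact .inl rfl
    | node w P b c vs rs q => exact hsound.1.admissible.2.2.2.1

/-- The certificate of a best draft is at least as high as any for which the reports contain a
quorum of votes. -/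
theorem Draft.Best.view_le {s : LocalState n Tx} {d : Draft n Tx} (h : d.Best f ExVal s)
    {c : Block n Tx} (hc : Ancestor c d.parent) (hq : n - f ≤ (voters d.reports c).card) :
    c.view ≤ d.certified.view := by
  classical
  by_contra! hlt
  -- The reported votes for `c` themselves form a certificate; using it would improve on the best
  -- draft.
  let vs : List (Fin n × Block n Tx) :=
    (d.reports.filter fun x => c ∈ x.2).map fun x => (x.1, c)
  have hmem : ∀ x ∈ vs, x.2 = c ∧ ∃ y ∈ d.reports, x.1 = y.1 ∧ x.2 ∈ y.2 := by
    intro x hx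
    simp only [vs, List.mem_map, List.mem_filter, decide_eq_true_eq] at hx
    obtain ⟨y, ⟨hy, hcy⟩, rfl⟩ := hx
    exact ⟨rfl, y, hy, rfl, hcy⟩
  have := h.2 { d with certified := c, votes := vs }
    { h.1 with
      ancestor := hc
      isQC := by
        refine .inr ⟨fun x hx => (hmem x hx).1 ▸ .refl _, hq.trans (Finset.card_le_card ?_)⟩
        intro r hr
        obtain ⟨x, hx, rfl, hX⟩ := mem_voters.1 hr
        simp only [List.mem_toFinset, List.mem_map]
        exact ⟨(x.1, c), List.mem_map.2 ⟨x, by simp [hx, hX], rfl⟩, rfl⟩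
      certified_view := h.1.certified_view.trans hlt.le
      votes_mem := .inl fun x hx => (hmem x hx).2 }
  simp only at this
  omega

/-- The block proposed according to a proper draft is sound. -/
theorem Draft.Proper.sound {s : LocalState n Tx} {d : Draft n Tx} (h : d.Proper f ExVal s)
    {b : Tx} (hb : ExVal b) :
    Sound f ExVal (.node s.view d.parent b d.certified d.votes d.reports d.proofs) := by
  have hr : ∀ x ∈ d.reports, ∀ X ∈ x.2, Sound f ExVal X := fun x hx X hX =>
    ((mem_goodReports.1 (h.reports_eq ▸ hx)).2 X hX).1
  have hP : Sound f ExVal d.parent := by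
    rcases h.parent_mem with h | ⟨x, hx, hX⟩
    · exact h ▸ sound_genesis
    · exact hr x hx _ hX
  refine sound_of_part ⟨h.parent_view, hb, h.ancestor, h.isQC, h.certified_view, h.quorum,
    h.parent_mem, h.precedes⟩ ?_
  rintro D (rfl | rfl | ⟨x, hx, rfl⟩ | ⟨x, hx, hX⟩ | ⟨x, hx, hX⟩)
  · exact hP
  · exact hP.of_parts h.ancestor.parts
  · rcases h.votes_mem with hv | hv
    · obtain ⟨y, hy, -, hX⟩ := hv x hx
      exact hr y hy _ hX
    · rw [hv] at hx
      refine hP.of_parts (.single ?_)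
      revert hx
      cases d.parent with
      | genesis => simp [qcVotes]
      | node => exact fun hx => .inr (.inr (.inl ⟨x, hx, rfl⟩))
  · exact hr x hx _ hX
  · rw [h.proofs_eq] at hx
    obtain ⟨⟨y, hy, hY⟩, ⟨z, hz, hZ⟩⟩ := mem_equivocations hx
    rcases hX with rfl | rfl
    · exact hr y hy _ hY
    · exact hr z hz _ hZ

end Protocol

/-! ### Authenticity -/

section Authentic

variable {leader : ℕ → Fin n} {F : Finset (Fin n)} {σ τ : Fin n → LocalState n Tx}

theorem Authentic.of_parts {D B : Block n Tx} (h : Authentic leader F σ B)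
    (hD : Relation.ReflTransGen Part D B) : Authentic leader F σ D :=
  fun C hC => h C (hC.trans hD)

theorem authentic_genesis : Authentic leader F σ (genesis : Block n Tx) := by
  intro D hD
  rcases hD.cases_tail with rfl | ⟨C, -, hC⟩
  · trivial
  · exact hC.elim

theorem Authentic.mem_proposed {B : Block n Tx} (h : Authentic leader F σ B) (hB : B ≠ genesis)
    (hL : leader B.view ∈ F) : B ∈ (σ (leader B.view)).proposed := by
  have := h B .refl
  cases B with
  | genesis => exact absurd rfl hB
  | node w P b c vs rs q => exact this.1 hL

theorem Authentic.mem_sent {B : Block n Tx} (h : Authentic leader F σ B)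
    {x : Fin n × List (Block n Tx)} (hx : x ∈ B.reports) (hF : x.1 ∈ F) :
    (⟨x.1, B.view, x.2⟩ : Report n Tx) ∈ (σ x.1).sent := by
  have := h B .refl
  cases B with
  | genesis => simp [reports] at hx
  | node w P b c vs rs q => exact this.2.2 x hx hF

theorem Authentic.mem_votes {B : Block n Tx} (h : Authentic leader F σ B)
    {x : Fin n × Block n Tx} (hx : x ∈ B.qcVotes) (hF : x.1 ∈ F) : x.2 ∈ (σ x.1).votes := by
  have := h B .refl
  cases B with
  | genesis => simp [qcVotes] at hx
  | node w P b c vs rs q => exact this.2.1 x hx hF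

theorem authentic_node {w : ℕ} {P : Block n Tx} {b : Tx} {c : Block n Tx}
    {vs : List (Fin n × Block n Tx)} {rs : List (Fin n × List (Block n Tx))}
    {q : List (Block n Tx × Block n Tx)}
    (h₁ : leader w ∈ F → Block.node w P b c vs rs q ∈ (σ (leader w)).proposed)
    (h₂ : ∀ x ∈ vs, x.1 ∈ F → x.2 ∈ (σ x.1).votes)
    (h₃ : ∀ x ∈ rs, x.1 ∈ F → (⟨x.1, w, x.2⟩ : Report n Tx) ∈ (σ x.1).sent)
    (h : ∀ D, Part D (.node w P b c vs rs q) → Authentic leader F σ D) :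
    Authentic leader F σ (.node w P b c vs rs q) := by
  intro D hD
  rcases hD.cases_tail with rfl | ⟨C, hDC, hC⟩
  · exact ⟨h₁, h₂, h₃⟩
  · exact h C hC D hDC

/-- Signatures are tracked by lists that only grow, so authenticity persists in time. -/
theorem Authentic.mono {B : Block n Tx} (h : Authentic leader F σ B)
    (h₁ : ∀ r ∈ F, (σ r).proposed ⊆ (τ r).proposed) (h₂ : ∀ r ∈ F, (σ r).votes ⊆ (τ r).votes)
    (h₃ : ∀ r ∈ F, (σ r).sent ⊆ (τ r).sent) : Authentic leader F τ B := by
  intro D hD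
  have := h D hD
  cases D with
  | genesis => trivial
  | node w P b c vs rs q =>
    exact ⟨fun hL => h₁ _ hL (this.1 hL), fun x hx hF => h₂ _ hF (this.2.1 x hx hF),
      fun x hx hF => h₃ _ hF (this.2.2 x hx hF)⟩

end Authentic

/-! ### Single steps -/

section Step

variable {P : Protocol n f Tx} {leader : ℕ → Fin n} {ExVal : Tx → Prop} {batch : ℕ → Tx}
  {r : Fin n} {s : LocalState n Tx} {a : Input n Tx}

/-- The possible reactions to an input, apart from proposing. -/
inductive InputStep (P : Protocol n f Tx) (leader : ℕ → Fin n) (ExVal : Tx → Prop) (r : Fin n)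
    (s : LocalState n Tx) : Input n Tx → LocalState n Tx → Prop
  | ignore (a : Input n Tx) : InputStep P leader ExVal r s a s
  | advance (w : ℕ) : s.view < w → InputStep P leader ExVal r s (.advance w) (s.enter r w)
  | timer : InputStep P leader ExVal r s (.timer s.view) { s with timer := true }
  | report (m : Report n Tx) : m.sender ∉ s.slashed →
      InputStep P leader ExVal r s (.report m) { s with inbox := m :: s.inbox }
  | slash (B : Block n Tx) :
      InputStep P leader ExVal r s (.proposal B)
        { s with slashed := s.slashed ∪ B.convicted leader }
  | vote (B : Block n Tx) : B.view = s.view →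
      P.accept r { s with slashed := s.slashed ∪ B.convicted leader } B →
      InputStep P leader ExVal r s (.proposal B)
        (LocalState.enter r { s with
          slashed := s.slashed ∪ B.convicted leader
          votes := B :: s.votes } (B.view + 1))

theorem onInput_step : InputStep P leader ExVal r s a (P.onInput leader ExVal r s a) := by
  classical
  cases a with
  | advance w =>
    simp only [Protocol.onInput]
    split_ifs with h
    · exact .advance w h
    · exact .ignore _
  | timer w =>
    simp only [Protocol.onInput]
    split_ifs with h
    · subst h
      exact .timer
    · exact .ignore _
  | report m =>
    simp only [Protocol.onInput]
    split_ifs with h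
    · exact .ignore _
    · exact .report m h
  | proposal B =>
    simp only [Protocol.onInput, Protocol.onProposal]
    split_ifs with h h'
    · exact .vote B h.1 h'.2
    · exact .slash B
    · exact .ignore _

/-- A replica that gets a valid and acceptable proposal for its current view votes for it. -/
theorem onInput_proposal {B : Block n Tx} (hv : B.view = s.view) (hL : leader B.view ∉ s.slashed)
    (hB : B.Valid f ExVal)
    (ha : P.accept r { s with slashed := s.slashed ∪ B.convicted leader } B) :
    B ∈ (P.onInput leader ExVal r s (.proposal B)).votes := by
  simp only [Protocol.onInput, Protocol.onProposal]
  rw [if_pos ⟨hv, hL⟩, if_pos ⟨hB, ha⟩]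
  simp [LocalState.enter]

/-- The leader either does nothing or proposes a block. -/
inductive ProposeStep (P : Protocol n f Tx) (leader : ℕ → Fin n) (r : Fin n) (b : Tx)
    (s : LocalState n Tx) : LocalState n Tx → Prop
  | none : ProposeStep P leader r b s s
  | some (d : Draft n Tx) : leader s.view = r → (∀ B ∈ s.proposed, B.view ≠ s.view) →
      P.propose r s = some d →
      ProposeStep P leader r b s
        { s with
          proposed :=
            .node s.view d.parent b d.certified d.votes d.reports d.proofs :: s.proposed }

theorem tryPropose_step {b : Tx} : ProposeStep P leader r b s (P.tryPropose leader r b s) := by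
  classical
  simp only [Protocol.tryPropose]
  split_ifs with h
  · cases hd : P.propose r s with
    | none => exact .none
    | some d => exact .some d h.1 h.2 hd
  · exact .none

theorem tryPropose_of_some {b : Tx} {d : Draft n Tx} (hL : leader s.view = r)
    (hd : P.propose r s = some d) :
    ∃ B ∈ (P.tryPropose leader r b s).proposed, B.view = s.view := by
  classical
  simp only [Protocol.tryPropose]
  split_ifs with h
  · rw [hd]
    exact ⟨_, List.mem_cons_self, rfl⟩
  -- A leader that may not propose has already proposed in this view, and that block is the witness.
  · push Not at h
    exact h hL

theorem tryPropose_fields (b : Tx) (s : LocalState n Tx) :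
    (P.tryPropose leader r b s).view = s.view ∧ (P.tryPropose leader r b s).votes = s.votes ∧
    (P.tryPropose leader r b s).sent = s.sent ∧ (P.tryPropose leader r b s).inbox = s.inbox ∧
    (P.tryPropose leader r b s).timer = s.timer ∧
    (P.tryPropose leader r b s).slashed = s.slashed ∧
    s.proposed ⊆ (P.tryPropose leader r b s).proposed := by
  generalize ht : P.tryPropose leader r b s = t
  have h : ProposeStep P leader r b s t := ht ▸ tryPropose_step
  cases h <;> simp

theorem InputStep.mono {s' : LocalState n Tx} (h : InputStep P leader ExVal r s a s') :
    s.view ≤ s'.view ∧ s.votes ⊆ s'.votes ∧ s.sent ⊆ s'.sent ∧ s.inbox ⊆ s'.inbox ∧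
    s'.proposed = s.proposed := by
  cases h with
  | advance w hw => simp [LocalState.enter, hw.le]
  | vote B hv _ => simp [LocalState.enter, hv]
  | _ => simp

theorem react_mono (P : Protocol n f Tx) (leader : ℕ → Fin n) (ExVal : Tx → Prop)
    (batch : ℕ → Tx) (r : Fin n) (s : LocalState n Tx) (a : Input n Tx) :
    s.view ≤ (P.react leader ExVal batch r s a).view ∧
    s.votes ⊆ (P.react leader ExVal batch r s a).votes ∧
    s.sent ⊆ (P.react leader ExVal batch r s a).sent ∧
    s.inbox ⊆ (P.react leader ExVal batch r s a).inbox ∧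
    s.proposed ⊆ (P.react leader ExVal batch r s a).proposed := by
  have h := (onInput_step (P := P) (leader := leader) (ExVal := ExVal) (r := r) (s := s)
    (a := a)).mono
  simp only [Protocol.react]
  obtain ⟨h1, h2, h3, h4, -, -, h6⟩ :=
    tryPropose_fields (P := P) (leader := leader) (r := r)
      (batch (P.onInput leader ExVal r s a).view) (P.onInput leader ExVal r s a)
  rw [h1, h2, h3, h4]
  exact ⟨h.1, h.2.1, h.2.2.1, h.2.2.2.1, h.2.2.2.2 ▸ h6⟩

/-! ### Local invariants -/

/-- What holds of the state of a replica that follows the protocol, whatever the inputs. -/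
structure LocalInv (P : Protocol n f Tx) (r : Fin n) (s : LocalState n Tx) : Prop where
  votes_view : ∀ X ∈ s.votes, X.view < s.view
  sent_sender : ∀ m ∈ s.sent, m.sender = r
  sent_view : ∀ m ∈ s.sent, m.view ≤ s.view
  mem_record : ∀ m ∈ s.sent, ∀ X ∈ s.votes, X.view < m.view → X ∈ m.record
  record : ∀ m ∈ s.sent, ∀ X ∈ m.record, X ∈ s.votes ∧ X.view < m.view
  proposed_view : ∀ B ∈ s.proposed, B.view ≤ s.view
  proposed_unique : ∀ B ∈ s.proposed, ∀ B' ∈ s.proposed, B.view = B'.view → B = B'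
  accepted : ∀ X ∈ s.votes, ∃ t, P.accept r t X

theorem LocalInv.initial : LocalInv P r LocalState.initial := by
  constructor <;> simp [LocalState.initial]

theorem LocalInv.enter (h : LocalInv P r s) {w : ℕ} (hw : s.view < w) :
    LocalInv P r (s.enter r w) where
  votes_view X hX := (h.votes_view X hX).trans hw
  sent_sender m hm := by
    rcases List.mem_cons.1 hm with rfl | hm
    · rfl
    · exact h.sent_sender m hm
  sent_view m hm := by
    rcases List.mem_cons.1 hm with rfl | hm
    · exact le_rfl
    · exact (h.sent_view m hm).trans hw.le
  mem_record m hm X hX hlt := by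
    rcases List.mem_cons.1 hm with rfl | hm
    · exact hX
    · exact h.mem_record m hm X hX hlt
  record m hm X hX := by
    rcases List.mem_cons.1 hm with rfl | hm
    · exact ⟨hX, (h.votes_view X hX).trans hw⟩
    · exact h.record m hm X hX
  proposed_view B hB := (h.proposed_view B hB).trans hw.le
  proposed_unique := h.proposed_unique
  accepted := h.accepted

theorem LocalInv.inputStep (h : LocalInv P r s) {s' : LocalState n Tx}
    (hs : InputStep P leader ExVal r s a s') : LocalInv P r s' := by
  cases hs with
  | ignore => exact h
  | advance w hw => exact h.enter hw
  | timer => exact { h with }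
  | report m _ => exact { h with }
  | slash B => exact { h with }
  | vote B hv ha =>
    constructor
    · intro X hX
      rcases List.mem_cons.1 hX with rfl | hX
      · exact Nat.lt_succ_self _
      · exact (h.votes_view X hX).trans_le (hv ▸ Nat.le_succ _)
    · intro m hm
      rcases List.mem_cons.1 hm with rfl | hm
      · rfl
      · exact h.sent_sender m hm
    · intro m hm
      rcases List.mem_cons.1 hm with rfl | hm
      · exact le_rfl
      · exact (h.sent_view m hm).trans (hv ▸ Nat.le_succ _)
    · intro m hm X hX hlt
      rcases List.mem_cons.1 hm with rfl | hm
      · exact hX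
      · rcases List.mem_cons.1 hX with rfl | hX
        · have := h.sent_view m hm
          omega
        · exact h.mem_record m hm X hX hlt
    · intro m hm X hX
      rcases List.mem_cons.1 hm with rfl | hm
      · refine ⟨hX, ?_⟩
        rcases List.mem_cons.1 hX with rfl | hX
        · exact Nat.lt_succ_self _
        · exact (h.votes_view X hX).trans_le (hv ▸ Nat.le_succ _)
      · exact ⟨List.mem_cons_of_mem _ (h.record m hm X hX).1, (h.record m hm X hX).2⟩
    · exact fun C hC => (h.proposed_view C hC).trans (hv ▸ Nat.le_succ _)
    · exact h.proposed_unique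
    · intro X hX
      rcases List.mem_cons.1 hX with rfl | hX
      · exact ⟨_, ha⟩
      · exact h.accepted X hX

theorem LocalInv.proposeStep (h : LocalInv P r s) {s' : LocalState n Tx} {b : Tx}
    (hs : ProposeStep P leader r b s s') : LocalInv P r s' := by
  cases hs with
  | none => exact h
  | some d hL hnew hd =>
    refine { h with proposed_view := ?_, proposed_unique := ?_ }
    · intro B hB
      rcases List.mem_cons.1 hB with rfl | hB
      · exact le_rfl
      · exact h.proposed_view B hB
    · intro B hB B' hB' hv
      rcases List.mem_cons.1 hB with rfl | hB <;> rcases List.mem_cons.1 hB' with rfl | hB'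
      · rfl
      · exact absurd hv.symm (hnew B' hB')
      · exact absurd hv (hnew B hB)
      · exact h.proposed_unique B hB B' hB' hv

theorem LocalInv.react (h : LocalInv P r s) :
    LocalInv P r (P.react leader ExVal batch r s a) :=
  (h.inputStep onInput_step).proposeStep tryPropose_step

end Step

/-! ### Executions -/

namespace Execution

section General

variable {P : Protocol n f Tx} {leader : ℕ → Fin n} {ExVal : Tx → Prop}
  (E : Execution P leader ExVal)

theorem follows_card : E.followsᶜ.card ≤ f :=
  (Finset.card_le_card (Finset.compl_subset_compl.2 E.honest_subset)).trans E.faulty_card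

/-- A replica that follows the protocol reacts to a genuine input or keeps its state. -/
theorem step_cases (i : ℕ) {r : Fin n} (hr : r ∈ E.follows) :
    (E.actor i = r ∧ Genuine leader E.follows (E.state i) (E.input i) ∧
      E.state (i + 1) r = P.react leader ExVal E.batch r (E.state i r) (E.input i)) ∨
    E.state (i + 1) r = E.state i r := by
  by_cases h : E.actor i = r ∧ Genuine leader E.follows (E.state i) (E.input i)
  · exact .inl ⟨h.1, h.2, (E.state_step i r hr).1 h.1 h.2⟩
  · exact .inr ((E.state_step i r hr).2 h)

theorem mono_succ (i : ℕ) {r : Fin n} (hr : r ∈ E.follows) :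
    (E.state i r).view ≤ (E.state (i + 1) r).view ∧
    (E.state i r).votes ⊆ (E.state (i + 1) r).votes ∧
    (E.state i r).sent ⊆ (E.state (i + 1) r).sent ∧
    (E.state i r).inbox ⊆ (E.state (i + 1) r).inbox ∧
    (E.state i r).proposed ⊆ (E.state (i + 1) r).proposed := by
  rcases E.step_cases i hr with ⟨-, -, h⟩ | h
  · rw [h]
    exact react_mono ..
  · rw [h]
    simp

theorem mono {i j : ℕ} (hij : i ≤ j) {r : Fin n} (hr : r ∈ E.follows) :
    (E.state i r).view ≤ (E.state j r).view ∧
    (E.state i r).votes ⊆ (E.state j r).votes ∧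
    (E.state i r).sent ⊆ (E.state j r).sent ∧
    (E.state i r).inbox ⊆ (E.state j r).inbox ∧
    (E.state i r).proposed ⊆ (E.state j r).proposed := by
  induction j, hij using Nat.le_induction with
  | base => simp
  | succ j _ ih =>
    have h := E.mono_succ j hr
    exact ⟨ih.1.trans h.1, List.Subset.trans ih.2.1 h.2.1, List.Subset.trans ih.2.2.1 h.2.2.1,
      List.Subset.trans ih.2.2.2.1 h.2.2.2.1, List.Subset.trans ih.2.2.2.2 h.2.2.2.2⟩

theorem localInv (i : ℕ) {r : Fin n} (hr : r ∈ E.follows) : LocalInv P r (E.state i r) := by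
  induction i with
  | zero => exact E.state_zero r ▸ LocalInv.initial
  | succ i ih =>
    rcases E.step_cases i hr with ⟨-, -, h⟩ | h
    · exact h ▸ ih.react
    · exact h ▸ ih

/-- All signatures in `B` are genuine at step `i`. -/
def Signed (i : ℕ) (B : Block n Tx) : Prop := Authentic leader E.follows (E.state i) B

variable {E}

theorem Signed.mono {i j : ℕ} (hij : i ≤ j) {B : Block n Tx} (h : E.Signed i B) :
    E.Signed j B :=
  Authentic.mono h (fun _ hr => (E.mono hij hr).2.2.2.2) (fun _ hr => (E.mono hij hr).2.1)
    (fun _ hr => (E.mono hij hr).2.2.1)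

theorem Signed.of_parts {i : ℕ} {D B : Block n Tx} (h : E.Signed i B)
    (hD : Relation.ReflTransGen Part D B) : E.Signed i D :=
  Authentic.of_parts h hD

variable (E)

/-- What is authentic in the state of a replica that follows the protocol. -/
structure AuthInv (i : ℕ) (r : Fin n) : Prop where
  votes : ∀ X ∈ (E.state i r).votes, E.Signed i X
  inbox_record : ∀ m ∈ (E.state i r).inbox, ∀ X ∈ m.record, E.Signed i X
  inbox_sent : ∀ m ∈ (E.state i r).inbox, m.sender ∈ E.follows →
    m ∈ (E.state i m.sender).sent
  proposed : ∀ X ∈ (E.state i r).proposed, E.Signed i X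
  slashed : ∀ p ∈ (E.state i r).slashed, p ∉ E.follows

theorem not_mem_follows_of_convicted {i : ℕ} {B : Block n Tx} (hB : E.Signed i B) {p : Fin n}
    (hp : p ∈ B.convicted leader) : p ∉ E.follows := by
  intro hF
  simp only [Block.convicted, Finset.mem_filter, Finset.mem_univ, true_and] at hp
  obtain ⟨x, hx, h1, h2, hne, hv, rfl⟩ := hp
  have hpart : Part x.1 B ∧ Part x.2 B := by
    cases B with
    | genesis => simp [Block.proofs] at hx
    | node w P b c vs rs q =>
      exact ⟨.inr (.inr (.inr (.inr ⟨x, hx, .inl rfl⟩))),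
        .inr (.inr (.inr (.inr ⟨x, hx, .inr rfl⟩)))⟩
  have hm1 := Authentic.mem_proposed (hB.of_parts (.single hpart.1)) h1 hF
  have hm2 := Authentic.mem_proposed (hB.of_parts (.single hpart.2)) h2 (hv ▸ hF)
  rw [← hv] at hm2
  exact hne ((E.localInv i hF).proposed_unique _ hm1 _ hm2 hv)

theorem AuthInv.of_eq {i : ℕ} {r : Fin n} (h : E.AuthInv i r)
    (he : E.state (i + 1) r = E.state i r) : E.AuthInv (i + 1) r where
  votes X hX := (h.votes X (he ▸ hX)).mono (Nat.le_succ i)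
  inbox_record m hm X hX := (h.inbox_record m (he ▸ hm) X hX).mono (Nat.le_succ i)
  inbox_sent m hm hF := (E.mono (Nat.le_succ i) hF).2.2.1 (h.inbox_sent m (he ▸ hm) hF)
  proposed X hX := (h.proposed X (he ▸ hX)).mono (Nat.le_succ i)
  slashed p hp := h.slashed p (he ▸ hp)

/-- The invariant for everything but the proposals, after an input. -/
theorem AuthInv.inputStep {i : ℕ} {r : Fin n} (h : E.AuthInv i r)
    (hg : Genuine leader E.follows (E.state i) (E.input i)) {s' : LocalState n Tx}
    (hs : InputStep P leader ExVal r (E.state i r) (E.input i) s') :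
    (∀ X ∈ s'.votes, E.Signed i X) ∧ (∀ m ∈ s'.inbox, ∀ X ∈ m.record, E.Signed i X) ∧
    (∀ m ∈ s'.inbox, m.sender ∈ E.follows → m ∈ (E.state i m.sender).sent) ∧
    (∀ p ∈ s'.slashed, p ∉ E.follows) := by
  generalize hin : E.input i = a at hs hg
  cases hs with
  | ignore => exact ⟨h.votes, h.inbox_record, h.inbox_sent, h.slashed⟩
  | advance w hw => exact ⟨h.votes, h.inbox_record, h.inbox_sent, h.slashed⟩
  | timer => exact ⟨h.votes, h.inbox_record, h.inbox_sent, h.slashed⟩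
  | report m _ =>
    refine ⟨h.votes, ?_, ?_, h.slashed⟩
    · intro m' hm'
      rcases List.mem_cons.1 hm' with rfl | hm'
      · exact hg.2
      · exact h.inbox_record m' hm'
    · intro m' hm'
      rcases List.mem_cons.1 hm' with rfl | hm'
      · exact hg.1
      · exact h.inbox_sent m' hm'
  | slash B =>
    refine ⟨h.votes, h.inbox_record, h.inbox_sent, ?_⟩
    intro p hp
    rcases Finset.mem_union.1 hp with hp | hp
    · exact h.slashed p hp
    · exact E.not_mem_follows_of_convicted hg hp
  | vote B hv ha =>
    refine ⟨?_, h.inbox_record, h.inbox_sent, ?_⟩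
    · intro X hX
      rcases List.mem_cons.1 hX with rfl | hX
      · exact hg
      · exact h.votes X hX
    · intro p hp
      rcases Finset.mem_union.1 hp with hp | hp
      · exact h.slashed p hp
      · exact E.not_mem_follows_of_convicted hg hp

end General

section Main

variable {leader : ℕ → Fin n} {ExVal : Tx → Prop} {Δ Tf : ℝ} {hΔ : 0 < Δ} {hTf : 0 ≤ Tf}
  (E : Execution (protocol n f ExVal Δ Tf hΔ hTf) leader ExVal)

theorem authInv (i : ℕ) {r : Fin n} (hr : r ∈ E.follows) : E.AuthInv i r := by
  induction i with
  | zero => constructor <;> simp [E.state_zero, LocalState.initial]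
  | succ i ih =>
    rcases E.step_cases i hr with ⟨-, hg, h⟩ | h
    swap
    · exact ih.of_eq E h
    simp only [Protocol.react] at h
    set s' := (protocol n f ExVal Δ Tf hΔ hTf).onInput leader ExVal r (E.state i r) (E.input i)
      with hs'
    have hstep : InputStep (protocol n f ExVal Δ Tf hΔ hTf) leader ExVal r (E.state i r)
      (E.input i) s' := onInput_step
    obtain ⟨h1, h2, h3, h4⟩ := ih.inputStep E hg hstep
    obtain ⟨-, e2, -, e4, -, e6, -⟩ :=
      tryPropose_fields (P := protocol n f ExVal Δ Tf hΔ hTf) (leader := leader) (r := r)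
        (E.batch s'.view) s'
    rw [← h] at e2 e4 e6
    rw [← e2] at h1
    rw [← e4] at h2 h3
    rw [← e6] at h4
    refine ⟨fun X hX => (h1 X hX).mono (Nat.le_succ i),
      fun m hm X hX => (h2 m hm X hX).mono (Nat.le_succ i),
      fun m hm hF => (E.mono (Nat.le_succ i) hF).2.2.1 (h3 m hm hF), ?_, h4⟩
    have hprop : ∀ X ∈ s'.proposed, E.Signed (i + 1) X := fun X hX =>
      (ih.proposed X (hstep.mono.2.2.2.2 ▸ hX)).mono (Nat.le_succ i)
    have hps : ProposeStep (protocol n f ExVal Δ Tf hΔ hTf) leader r (E.batch s'.view) s'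
      (E.state (i + 1) r) := h ▸ tryPropose_step
    generalize ht : E.state (i + 1) r = t at hps
    cases hps with
    | none => exact hprop
    | some d hL hnew hd =>
      intro X hX
      rcases List.mem_cons.1 hX with rfl | hX'
      swap
      · exact hprop X hX'
      have hd := (protocol_propose_eq_some hd).2.1
      have hrep : ∀ x ∈ d.reports, (∀ X ∈ x.2, E.Signed (i + 1) X) ∧ (x.1 ∈ E.follows →
          (⟨x.1, s'.view, x.2⟩ : Report n Tx) ∈ (E.state (i + 1) x.1).sent) := by
        intro x hx
        rw [hd.reports_eq] at hx
        obtain ⟨⟨m, hm, hmv, rfl⟩, -⟩ := mem_goodReports.1 hx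
        rw [← e4] at hm
        refine ⟨fun X hX => (h2 m hm X hX).mono (Nat.le_succ i), fun hF => ?_⟩
        rw [← hmv]
        exact (E.mono (Nat.le_succ i) hF).2.2.1 (h3 m hm hF)
      have hpar : E.Signed (i + 1) d.parent := by
        rcases hd.parent_mem with h | ⟨x, hx, hX⟩
        · exact h ▸ authentic_genesis
        · exact (hrep x hx).1 _ hX
      have hvotes : ∀ x ∈ d.votes,
          E.Signed (i + 1) x.2 ∧ (x.1 ∈ E.follows → x.2 ∈ (E.state (i + 1) x.1).votes) := by
        intro x hx
        rcases hd.votes_mem with hv | hv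
        · obtain ⟨y, hy, hxy, hX⟩ := hv x hx
          refine ⟨(hrep y hy).1 _ hX, fun hF => ?_⟩
          rw [hxy] at hF ⊢
          exact ((E.localInv (i + 1) hF).record _ ((hrep y hy).2 hF) _ hX).1
        · rw [hv] at hx
          refine ⟨hpar.of_parts (.single ?_), fun hF => Authentic.mem_votes hpar hx hF⟩
          revert hx
          cases d.parent with
          | genesis => simp [qcVotes]
          | node => exact fun hx => .inr (.inr (.inl ⟨x, hx, rfl⟩))
      refine authentic_node (fun _ => ?_) (fun x hx => (hvotes x hx).2)
        (fun x hx => (hrep x hx).2) ?_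
      · rw [hL, ht]
        exact hX
      · rintro D (rfl | rfl | ⟨x, hx, rfl⟩ | ⟨x, hx, hX⟩ | ⟨x, hx, hX⟩)
        · exact hpar
        · exact hpar.of_parts hd.ancestor.parts
        · exact (hvotes x hx).1
        · exact (hrep x hx).1 _ hX
        · rw [hd.proofs_eq] at hx
          obtain ⟨⟨y, hy, hY⟩, ⟨z, hz, hZ⟩⟩ := mem_equivocations hx
          rcases hX with rfl | rfl
          · exact (hrep y hy).1 _ hY
          · exact (hrep z hz).1 _ hZ

theorem sound_of_mem_votes {i : ℕ} {r : Fin n} (hr : r ∈ E.follows) {X : Block n Tx}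
    (hX : X ∈ (E.state i r).votes) : X ≠ genesis ∧ Sound f ExVal X :=
  ((E.localInv i hr).accepted X hX).choose_spec

end Main

end Execution

namespace Execution

variable {leader : ℕ → Fin n} {ExVal : Tx → Prop} {Δ Tf : ℝ} {hΔ : 0 < Δ} {hTf : 0 ≤ Tf}
  {E : Execution (protocol n f ExVal Δ Tf hΔ hTf) leader ExVal} {i : ℕ}

/-! ### Locks are respected -/

theorem Signed.mem_report {B : Block n Tx} (h : E.Signed i B)
    {x : Fin n × List (Block n Tx)} (hx : x ∈ B.reports) (hF : x.1 ∈ E.follows)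
    {X : Block n Tx} : X ∈ x.2 ↔ X ∈ (E.state i x.1).votes ∧ X.view < B.view := by
  have hm := Authentic.mem_sent h hx hF
  exact ⟨fun hX => (E.localInv i hF).record _ hm X hX,
    fun hX => (E.localInv i hF).mem_record _ hm X hX.1 hX.2⟩

/-- Locks of different blocks of the same view agree. -/
theorem ancestor_of_locks (hf : 3 * f < n) {A B k k' : Block n Tx} (hB : Sound f ExVal B)
    (hB' : E.Signed i B) (hne : B ≠ genesis) (hA : E.Signed i A) (hv : A.view = B.view)
    (hk : Locks f B k) (hk' : Locks f A k') (hle : k.view ≤ k'.view) : Ancestor k k' := by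
  obtain ⟨r, hrF, hr, hr'⟩ := exists_mem_quorums hf hk'.1 (hB.quorum hne) E.follows_card
  obtain ⟨x, hx, rfl, hX⟩ := mem_voters.1 hr
  simp only [List.mem_toFinset, List.mem_map] at hr'
  obtain ⟨y, hy, hyx⟩ := hr'
  have h1 := (hA.mem_report hx hrF).1 hX
  rw [hv, ← hyx] at h1
  exact hk.2 y hy k' ((hB'.mem_report hy (hyx ▸ hrF)).2 h1) hle

/-- If a quorum has voted for `B`, then a block that is extended by all blocks of the same view
that are preferred to `B` is extended by all blocks of higher views. -/
theorem ancestor_of_view_lt (hf : 3 * f < n) {B k : Block n Tx} {V : Finset (Fin n)}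
    (hV : n - f ≤ V.card) (hvotes : ∀ r ∈ V, r ∈ E.follows → B ∈ (E.state i r).votes)
    (hbase : ∀ A : Block n Tx, Sound f ExVal A → E.Signed i A → A.view = B.view →
      Precedes f B A → Ancestor k A) :
    ∀ D : Block n Tx, Sound f ExVal D → E.Signed i D → B.view < D.view → Ancestor k D := by
  suffices ∀ w, ∀ D : Block n Tx, D.view = w → Sound f ExVal D → E.Signed i D →
      B.view < D.view → Ancestor k D from fun D => this _ D rfl
  intro w
  induction w using Nat.strong_induction_on with
  | _ w ih =>
    rintro D rfl hD hD' hlt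
    have hne : D ≠ genesis := by
      rintro rfl
      simp [Block.view] at hlt
    obtain ⟨r, hrF, hr, hr'⟩ := exists_mem_quorums hf hV (hD.quorum hne) E.follows_card
    simp only [List.mem_toFinset, List.mem_map] at hr'
    obtain ⟨x, hx, rfl⟩ := hr'
    have hX := (hD'.mem_report hx hrF).2 ⟨hvotes _ hr hrF, hlt⟩
    obtain ⟨P, hPart, hanc, hPv, -, hmax⟩ := hD.exists_parent hne
    have hP := hD.of_parts (.single hPart)
    have hP' := hD'.of_parts (.single hPart)
    have hpre := hmax x hx B hX
    refine Ancestor.trans ?_ hanc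
    rcases hpre.view_le.lt_or_eq with h | h
    · exact ih P.view hPv P rfl hP hP' h
    · exact hbase P hP hP' h.symm hpre

/-- If a quorum has voted for `B`, then all blocks of higher views extend what `B` locks. -/
theorem ancestor_of_locks_of_view_lt (hf : 3 * f < n) {B k : Block n Tx} (hB : Sound f ExVal B)
    (hB' : E.Signed i B) (hne : B ≠ genesis) (hk : Locks f B k)
    {V : Finset (Fin n)} (hV : n - f ≤ V.card)
    (hvotes : ∀ r ∈ V, r ∈ E.follows → B ∈ (E.state i r).votes) {D : Block n Tx}
    (hD : Sound f ExVal D) (hD' : E.Signed i D) (hlt : B.view < D.view) : Ancestor k D := by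
  refine ancestor_of_view_lt hf hV hvotes (fun A hA hA' hv hpre => ?_) D hD hD' hlt
  have hkB := hk.ancestor hf hB
  rcases Nat.eq_zero_or_pos k.view with h0 | h0
  · rw [(hB.of_parts hkB.parts).eq_genesis h0]
    exact genesis_ancestor A
  · have hle : k.view ≤ lockView f A := by
      refine (hk.le_lockView (hB.view_le hkB)).trans ?_
      rcases hpre with h | h
      · omega
      · exact h.2
    obtain ⟨k', hk', hv'⟩ := exists_locks_of_lockView_pos (h0.trans_le hle)
    exact (ancestor_of_locks hf hB hB' hne hA' hv hk hk' (hv' ▸ hle)).trans (hk'.ancestor hf hA)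

/-! ### Safety -/

/-- What makes a replica commit: a block that locks the committed block, with a quorum of votes. -/
theorem exists_lock_of_committed (hf : 3 * f < n) {r : Fin n} (hr : r ∈ E.follows)
    {C : Block n Tx} (h : (protocol n f ExVal Δ Tf hΔ hTf).Committed (E.state i r) C) :
    ∃ B k, Sound f ExVal B ∧ E.Signed i B ∧ B ≠ genesis ∧ Locks f B k ∧ Ancestor C k ∧
      ∃ V : Finset (Fin n), n - f ≤ V.card ∧
        ∀ r ∈ V, r ∈ E.follows → B ∈ (E.state i r).votes := by
  obtain ⟨D, hD, k, hk, hC⟩ := h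
  obtain ⟨-, B, hV, hlock⟩ := protocol_commitRule_eq_some hk
  have hDs := (E.sound_of_mem_votes hr hD).2
  have hD' : E.Signed i D := (E.authInv i hr).votes D hD
  have hpart := parts_of_mem_voters hf hV
  refine ⟨B, k, hDs.of_parts (.single hpart), hD'.of_parts (.single hpart), ?_, hlock, hC, _, hV,
    ?_⟩
  · rintro rfl
    exact parts_of_mem_voters hf hlock.1
  · intro q hq hqF
    obtain ⟨x, hx, rfl, hX⟩ := mem_voters.1 hq
    exact ((hD'.mem_report hx hqF).1 hX).1

theorem Signed.locks_total (hf : 3 * f < n) {B k B' k' : Block n Tx} (hB : Sound f ExVal B)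
    (hBs : E.Signed i B) (hne : B ≠ genesis) (hk : Locks f B k)
    {V : Finset (Fin n)} (hV : n - f ≤ V.card)
    (hvotes : ∀ r ∈ V, r ∈ E.follows → B ∈ (E.state i r).votes) (hB' : Sound f ExVal B')
    (hBs' : E.Signed i B') (hne' : B' ≠ genesis) (hk' : Locks f B' k') (hle : B.view ≤ B'.view) :
    Ancestor k k' ∨ Ancestor k' k := by
  rcases hle.lt_or_eq with h | h
  · exact (ancestor_of_locks_of_view_lt hf hB hBs hne hk hV hvotes hB' hBs' h).total
      (hk'.ancestor hf hB')
  · rcases le_total k.view k'.view with hkk | hkk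
    · exact .inl (ancestor_of_locks hf hB hBs hne hBs' h.symm hk hk' hkk)
    · exact .inr (ancestor_of_locks hf hB' hBs' hne' hBs h hk' hk hkk)

end Execution

theorem Protocol.Committed.mono {P : Protocol n f Tx} {s t : LocalState n Tx} {B : Block n Tx}
    (h : P.Committed s B) (hst : s.votes ⊆ t.votes) : P.Committed t B := by
  obtain ⟨D, hD, h⟩ := h
  exact ⟨D, hst hD, h⟩

section Properties

variable {leader : ℕ → Fin n} {ExVal : Tx → Prop} {Δ Tf : ℝ} {hΔ : 0 < Δ} {hTf : 0 ≤ Tf}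

theorem protocol_safe (hf : 3 * f < n) :
    (protocol n f ExVal Δ Tf hΔ hTf).Safe leader ExVal := by
  intro E r hr r' hr' i j C C' hC hC' hconf
  have hrF := E.honest_subset hr
  have hrF' := E.honest_subset hr'
  obtain ⟨B, k, hB, hBs, hne, hk, hCk, V, hV, hvotes⟩ := Execution.exists_lock_of_committed hf hrF
    (hC.mono (E.mono (le_max_left i j) hrF).2.1)
  obtain ⟨B', k', hB', hBs', hne', hk', hCk', V', hV', hvotes'⟩ :=
    Execution.exists_lock_of_committed hf hrF' (hC'.mono (E.mono (le_max_right i j) hrF').2.1)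
  have htot : Ancestor k k' ∨ Ancestor k' k := by
    rcases le_total B.view B'.view with h | h
    · exact hBs.locks_total hf hB hne hk hV hvotes hB' hBs' hne' hk' h
    · exact (hBs'.locks_total hf hB' hne' hk' hV' hvotes' hB hBs hne hk h).symm
  have : Ancestor C C' ∨ Ancestor C' C := by
    rcases htot with h | h
    · exact (hCk.trans h).total hCk'
    · exact hCk.total (hCk'.trans h)
  exact this.elim hconf.1 hconf.2

theorem protocol_externallyValid :
    (protocol n f ExVal Δ Tf hΔ hTf).ExternallyValid leader ExVal := by
  intro E r hr i B b hB hb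
  obtain ⟨D, hD, k, hk, hBk⟩ := hB
  have hDs := (E.sound_of_mem_votes (E.honest_subset hr) hD).2
  have hcomm := (protocol_commitRule_eq_some hk).1
  have hBs := hDs.of_parts ((hBk.trans hcomm).parts.trans
    ((parts_certified _).trans (parts_certified _)))
  cases B with
  | genesis => simp [Block.batch] at hb
  | node w P b' c vs rs q =>
    simp only [Block.batch, Option.some.injEq] at hb
    exact hb ▸ hBs.admissible.2.1

theorem protocol_slashesOnlyDeviating :
    (protocol n f ExVal Δ Tf hΔ hTf).SlashesOnlyDeviating leader ExVal :=
  fun E _ hr i => (E.authInv i (E.honest_subset hr)).slashed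

end Properties

theorem exists_step {p : ℕ → Prop} (h0 : ¬ p 0) {m : ℕ} (hm : p m) :
    ∃ i < m, ¬ p i ∧ p (i + 1) := by
  induction m with
  | zero => exact absurd hm h0
  | succ m ih =>
    by_cases h : p m
    · obtain ⟨i, hi, h⟩ := ih h
      exact ⟨i, hi.trans (Nat.lt_succ_self m), h⟩
    · exact ⟨m, Nat.lt_succ_self m, h, hm⟩

namespace Execution

section General

variable {P : Protocol n f Tx} {leader : ℕ → Fin n} {ExVal : Tx → Prop}
  (E : Execution P leader ExVal)

/-- A step of a replica that follows the protocol, as an input step followed by a proposal. -/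
theorem step_split (i : ℕ) {r : Fin n} (hr : r ∈ E.follows) :
    ∃ s, (E.actor i = r ∧ InputStep P leader ExVal r (E.state i r) (E.input i) s ∨
        s = E.state i r) ∧
      ProposeStep P leader r (E.batch s.view) s (E.state (i + 1) r) ∧
      (E.state (i + 1) r).view = s.view ∧ (E.state (i + 1) r).votes = s.votes ∧
      (E.state (i + 1) r).sent = s.sent ∧ (E.state (i + 1) r).inbox = s.inbox ∧
      (E.state (i + 1) r).timer = s.timer ∧ s.proposed = (E.state i r).proposed := by
  rcases E.step_cases i hr with ⟨ha, -, h⟩ | h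
  · refine ⟨P.onInput leader ExVal r (E.state i r) (E.input i), .inl ⟨ha, onInput_step⟩, ?_⟩
    obtain ⟨h1, h2, h3, h4, h5, -, -⟩ := tryPropose_fields (P := P) (leader := leader) (r := r)
      (E.batch (P.onInput leader ExVal r (E.state i r) (E.input i)).view)
      (P.onInput leader ExVal r (E.state i r) (E.input i))
    rw [h]
    exact ⟨tryPropose_step, h1, h2, h3, h4, h5, onInput_step.mono.2.2.2.2⟩
  · refine ⟨E.state i r, .inr rfl, ?_⟩
    rw [h]
    exact ⟨.none, rfl, rfl, rfl, rfl, rfl, rfl⟩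

/-- On entering a view, a replica sends its report. -/
theorem Enters.exists_report {i w : ℕ} {r : Fin n} (h : E.Enters i r w) (hr : r ∈ E.follows) :
    ∃ m ∈ (E.state (i + 1) r).sent, m ∉ (E.state i r).sent ∧ m.sender = r ∧ m.view = w := by
  have hnew : ∀ m : Report n Tx, m.view = w → m ∉ (E.state i r).sent := by
    intro m hm hmem
    have h1 := (E.localInv i hr).sent_view m hmem
    have h2 := h.1
    omega
  obtain ⟨s, hs, -, hv, -, hsent, -⟩ := E.step_split i hr
  obtain ⟨h1, h2⟩ := h
  rw [hv] at h2
  rw [hsent]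
  rcases hs with ⟨-, hs⟩ | rfl
  swap
  · omega
  generalize E.input i = a at hs
  cases hs with
  | advance w' hw =>
    exact ⟨_, List.mem_cons_self, hnew _ h2, rfl, h2⟩
  | vote B hB ha =>
    exact ⟨_, List.mem_cons_self, hnew _ h2, rfl, h2⟩
  | _ => exact absurd h2 h1.ne

/-- If the timer of a replica has expired, it got a timer input for its current view. -/
theorem exists_timer_input (i : ℕ) {r : Fin n} (hr : r ∈ E.follows)
    (h : (E.state i r).timer = true) :
    ∃ j < i, E.actor j = r ∧ E.input j = .timer (E.state i r).view := by
  induction i with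
  | zero => simp [E.state_zero, LocalState.initial] at h
  | succ i ih =>
    obtain ⟨s, hs, -, hv, -, -, -, ht, -⟩ := E.step_split i hr
    rw [ht] at h
    rw [hv]
    have hold : (E.state i r).timer = true → s.view = (E.state i r).view →
        ∃ j < i + 1, E.actor j = r ∧ E.input j = .timer s.view := by
      intro h1 h2
      obtain ⟨j, hj, hj'⟩ := ih h1
      exact ⟨j, hj.trans (Nat.lt_succ_self i), h2 ▸ hj'⟩
    rcases hs with ⟨ha, hs⟩ | rfl
    swap
    · exact hold h rfl
    generalize hin : E.input i = a at hs
    cases hs with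
    | timer => exact ⟨i, Nat.lt_succ_self i, ha, hin⟩
    | advance w hw => simp [LocalState.enter] at h
    | vote B hB _ => simp [LocalState.enter] at h
    | _ => exact hold h rfl

/-- A replica that entered view `w` and is not made to leave it stays there until it votes. -/
theorem Enters.view_eq_or_voted {i w : ℕ} {r : Fin n} (h : E.Enters i r w)
    (hr : r ∈ E.follows) (j : ℕ) (hij : i < j)
    (hadv : ∀ k < j, ∀ w', E.actor k = r → (E.state k r).view = w →
      E.input k = .advance w' → ¬ w < w') :
    (E.state j r).view = w ∨
      ∃ k < j, (E.state k r).view = w ∧ ∃ X ∈ (E.state (k + 1) r).votes, X.view = w := by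
  induction j, hij using Nat.le_induction with
  | base => exact .inl h.2
  | succ j _ ih =>
    rcases ih fun k hk => hadv k (hk.trans (Nat.lt_succ_self j)) with hv | ⟨k, hk, hk'⟩
    swap
    · exact .inr ⟨k, hk.trans (Nat.lt_succ_self j), hk'⟩
    obtain ⟨s, hs, -, hv', hvotes, -⟩ := E.step_split j hr
    rw [hv']
    rcases hs with ⟨ha, hs⟩ | rfl
    swap
    · exact .inl hv
    generalize hin : E.input j = a at hs
    cases hs with
    | advance w' hw => exact absurd (hv ▸ hw) (hadv j (Nat.lt_succ_self j) w' ha hv hin)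
    | vote B hB _ =>
      refine .inr ⟨j, Nat.lt_succ_self j, hv, B, ?_, hB.trans hv⟩
      rw [hvotes]
      exact List.mem_cons_self
    | _ => exact .inl hv

end General

section Main

variable {leader : ℕ → Fin n} {ExVal : Tx → Prop} {Δ Tf : ℝ} {hΔ : 0 < Δ} {hTf : 0 ≤ Tf}
  (E : Execution (protocol n f ExVal Δ Tf hΔ hTf) leader ExVal)

theorem mem_inbox_of_delivered {j : ℕ} {r : Fin n} (hr : r ∈ E.follows) {m : Report n Tx}
    (ha : E.actor j = r) (hin : E.input j = .report m) (hm : m.sender ∈ E.follows)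
    (hsent : m ∈ (E.state j m.sender).sent) : m ∈ (E.state (j + 1) r).inbox := by
  have hg : Genuine leader E.follows (E.state j) (E.input j) := by
    rw [hin]
    exact ⟨fun _ => hsent, fun X hX => (E.authInv j hm).votes X
      ((E.localInv j hm).record m hsent X hX).1⟩
  rw [(E.state_step j r hr).1 ha hg]
  simp only [Protocol.react]
  rw [(tryPropose_fields _ _).2.2.2.1, hin]
  simp only [Protocol.onInput]
  rw [if_pos fun hs => (E.authInv j hr).slashed _ hs hm]
  exact List.mem_cons_self

theorem mem_votes_of_delivered {j : ℕ} {r : Fin n} (hr : r ∈ E.follows) {B : Block n Tx}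
    (ha : E.actor j = r) (hin : E.input j = .proposal B) (hB : Sound f ExVal B)
    (hne : B ≠ genesis) (hs : E.Signed j B) (hL : leader B.view ∈ E.follows)
    (hv : B.view = (E.state j r).view) : B ∈ (E.state (j + 1) r).votes := by
  have hg : Genuine leader E.follows (E.state j) (E.input j) := by
    rw [hin]
    exact hs
  rw [(E.state_step j r hr).1 ha hg]
  simp only [Protocol.react]
  rw [(tryPropose_fields _ _).2.1, hin]
  exact onInput_proposal hv (fun hs => (E.authInv j hr).slashed _ hs hL) hB.valid ⟨hne, hB⟩

variable {E}

/-- A leader that follows the protocol signs only one block per view. -/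
theorem Signed.eq_of_view_eq {i : ℕ} {A B : Block n Tx} (hA : E.Signed i A) (hB : E.Signed i B)
    (hA' : A ≠ genesis) (hB' : B ≠ genesis) (hv : A.view = B.view)
    (hL : leader B.view ∈ E.follows) : A = B := by
  have h1 := Authentic.mem_proposed hB hB' hL
  have h2 := Authentic.mem_proposed hA hA' (hv ▸ hL)
  rw [hv] at h2
  exact (E.localInv i hL).proposed_unique A h2 B h1 hv

/-- What a leader proposes. -/
theorem exists_best_of_proposed {i : ℕ} {r : Fin n} (hr : r ∈ E.follows) {B : Block n Tx}
    (h : B ∉ (E.state i r).proposed) (h' : B ∈ (E.state (i + 1) r).proposed) :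
    ∃ s d, Draft.Best f ExVal s d ∧ s.timer = true ∧ s.view = (E.state (i + 1) r).view ∧
      s.inbox = (E.state (i + 1) r).inbox ∧ (E.state (i + 1) r).timer = true ∧
      B = .node s.view d.parent (E.batch s.view) d.certified d.votes d.reports d.proofs := by
  obtain ⟨s, -, hp, hv, -, -, hin, ht, hprop⟩ := E.step_split i hr
  generalize hst : E.state (i + 1) r = t at *
  cases hp with
  | none => exact absurd (hprop ▸ h') h
  | some d hL hnew hd =>
    obtain ⟨ht', hbest⟩ := protocol_propose_eq_some hd
    refine ⟨s, d, hbest, ht', hv.symm, hin.symm, ht', ?_⟩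
    rcases List.mem_cons.1 h' with h' | h'
    · exact h'
    · exact absurd (hprop ▸ h') h

/-- Soundness of all proposals of replicas that follow the protocol. -/
theorem sound_of_mem_proposed {i : ℕ} {r : Fin n} (hr : r ∈ E.follows) {B : Block n Tx}
    (h : B ∈ (E.state i r).proposed) : Sound f ExVal B ∧ B ≠ genesis := by
  obtain ⟨j, -, hj, hj'⟩ := exists_step (p := fun i => B ∈ (E.state i r).proposed)
    (by simp [E.state_zero, LocalState.initial]) h
  obtain ⟨s, d, hd, -, -, -, -, rfl⟩ := exists_best_of_proposed hr hj hj'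
  exact ⟨hd.1.sound (E.batch_valid _), by simp⟩

/-- What happens in a synchronized view with an honest leader. -/
structure GoodView (E : Execution (protocol n f ExVal Δ Tf hΔ hTf) leader ExVal) (w : ℕ)
    (B : Block n Tx) (i : ℕ) : Prop where
  view_eq : B.view = w
  batch_eq : B.batch = some (E.batch w)
  proposed : B ∈ (E.state i (leader w)).proposed
  reports : ∀ r ∈ E.honest, ∃ x ∈ B.reports, x.1 = r
  certified : ∀ c, Ancestor c B → c.view < w → n - f ≤ (voters B.reports c).card →
    c.view ≤ B.certified.view
  voted : ∀ r ∈ E.honest, B ∈ (E.state i r).votes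
  voted_in_view : ∀ r ∈ E.honest, ∃ j, (E.state j r).view ≤ w ∧ B ∈ (E.state (j + 1) r).votes

theorem honest_card (E : Execution (protocol n f ExVal Δ Tf hΔ hTf) leader ExVal) :
    n - f ≤ E.honest.card := by
  have h1 := E.faulty_card
  rw [Finset.card_compl, Fintype.card_fin] at h1
  omega

/-- After the waiting time, the leader of a synchronized view has the reports of all honest
replicas. -/
theorem mem_inbox_of_synchronized {GST : ℝ} (hps : E.PartiallySynchronous GST Δ) {w : ℕ}
    (hL : leader w ∈ E.honest) {t₀ : ℝ} (hGST : GST ≤ t₀) {q : Fin n} (hq : q ∈ E.honest)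
    {i : ℕ} (hi : E.Enters i q w) (h₀ : t₀ ≤ E.time i) (h₁ : E.time i ≤ t₀ + Tf) {k : ℕ}
    (hk : t₀ + Tf + Δ < E.time k) :
    ∃ m ∈ (E.state k (leader w)).inbox, m.sender = q ∧ m.view = w ∧
      ∀ X ∈ m.record, Sound f ExVal X ∧ X.view < w := by
  have hqF := E.honest_subset hq
  obtain ⟨m, hm, hm', rfl, rfl⟩ := hi.exists_report E hqF
  obtain ⟨j, hij, ha, hin, ht⟩ := hps.report i _ hq m hm' hm hL
  have hjk : j < k := by
    by_contra! hkj
    have h1 := E.time_mono hkj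
    rw [max_eq_left (hGST.trans h₀)] at ht
    linarith
  refine ⟨m, (E.mono hjk (E.honest_subset hL)).2.2.2.1 (E.mem_inbox_of_delivered
    (E.honest_subset hL) ha hin hqF ((E.mono hij hqF).2.2.1 hm)), rfl, rfl, fun X hX => ?_⟩
  have := (E.localInv (i + 1) hqF).record m hm X hX
  exact ⟨(E.sound_of_mem_votes hqF this.1).2, this.2⟩

theorem exists_goodView {GST : ℝ} (hps : E.PartiallySynchronous GST Δ) {w : ℕ}
    (hL : leader w ∈ E.honest) (hsync : E.Synchronized GST Tf w) : ∃ B i, E.GoodView w B i := by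
  classical
  obtain ⟨t₀, hGST, henter, hadv⟩ := hsync
  have hLF := E.honest_subset hL
  have hinbox : ∀ k, t₀ + Tf + Δ < E.time k → ∀ q ∈ E.honest,
      ∃ m ∈ (E.state k (leader w)).inbox, m.sender = q ∧ m.view = w ∧
        ∀ X ∈ m.record, Sound f ExVal X ∧ X.view < w := by
    intro k hk q hq
    obtain ⟨i, hi, h0, h1⟩ := henter q hq
    exact mem_inbox_of_synchronized hps hL hGST hq hi h0 h1 hk
  have hgood : ∀ s : LocalState n Tx, s.view = w → (∀ q ∈ E.honest, ∃ m ∈ s.inbox,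
      m.sender = q ∧ m.view = w ∧ ∀ X ∈ m.record, Sound f ExVal X ∧ X.view < w) →
      ∀ q ∈ E.honest, ∃ x ∈ goodReports f ExVal s, x.1 = q := by
    intro s hs h q hq
    obtain ⟨m, hm, rfl, hmw, hX⟩ := h q hq
    exact ⟨(m.sender, m.record),
      mem_goodReports.2 ⟨⟨m, hm, hmw.trans hs.symm, rfl⟩, hs ▸ hX⟩, rfl⟩
  have hdur : (protocol n f ExVal Δ Tf hΔ hTf).duration = Tf + (Tf + Δ + 1) + Δ := rfl
  have hwait : (protocol n f ExVal Δ Tf hΔ hTf).wait = Tf + Δ + 1 := rfl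
  have hstay : ∀ q ∈ E.honest, ∀ i, E.Enters i q w → ∀ j, i < j →
      E.time j ≤ t₀ + (Tf + (Tf + Δ + 1) + Δ) → (E.state j q).view = w ∨
      ∃ k < j, (E.state k q).view = w ∧ ∃ X ∈ (E.state (k + 1) q).votes, X.view = w := by
    intro q hq i hi j hij ht
    refine hi.view_eq_or_voted E (E.honest_subset hq) j hij fun k hk w' ha hv hin hlt => ?_
    have h1 := hadv q hq k w' ha hv hin hlt
    have h2 := E.time_mono hk.le
    rw [hdur] at h1
    linarith
  obtain ⟨iL, hiL, hiL0, hiL1⟩ := henter _ hL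
  have hw : 0 < w := (Nat.zero_le _).trans_lt hiL.1
  -- every block of view `w` that gets a vote was proposed by the leader
  have hvoted : ∀ q ∈ E.honest, ∀ k, ∀ X ∈ (E.state (k + 1) q).votes, X.view = w →
      E.Signed (k + 1) X ∧ X ≠ genesis ∧ X ∈ (E.state (k + 1) (leader w)).proposed := by
    rintro q hq k X hX rfl
    have hne := (E.sound_of_mem_votes (E.honest_subset hq) hX).1
    have hs := (E.authInv (k + 1) (E.honest_subset hq)).votes X hX
    exact ⟨hs, hne, Authentic.mem_proposed hs hne hLF⟩
  -- the leader proposes when its timer expires, at the latest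
  obtain ⟨jL, hijL, haL, hinL, htL⟩ := hps.timer_fires iL _ hL w hiL
  rw [hwait] at htL
  have hprop : ∃ B ∈ (E.state (jL + 1) (leader w)).proposed, B.view = w := by
    rcases hstay _ hL iL hiL jL hijL (by linarith) with hv | ⟨k, hk, -, X, hX, hXw⟩
    · have hg : Genuine leader E.follows (E.state jL) (E.input jL) := by
        rw [hinL]
        trivial
      rw [(E.state_step jL _ hLF).1 haL hg, hinL]
      have hin : (protocol n f ExVal Δ Tf hΔ hTf).onInput leader ExVal (leader w)
          (E.state jL (leader w)) (.timer w) = { E.state jL (leader w) with timer := true } := by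
        simp only [Protocol.onInput]
        rw [if_pos hv]
      simp only [Protocol.react]
      rw [hin]
      have hrep := hgood { E.state jL (leader w) with timer := true } hv
        (hinbox jL (by linarith))
      obtain ⟨d, hd⟩ := protocol_propose_isSome (hΔ := hΔ) (hTf := hTf) (r := leader w)
        (s := { E.state jL (leader w) with timer := true }) rfl
        (exists_best (hw.trans_eq hv.symm) (E.honest_card.trans (Finset.card_le_card fun q hq => by
          obtain ⟨x, hx, rfl⟩ := hrep q hq
          exact List.mem_toFinset.2 (List.mem_map_of_mem hx))))
      obtain ⟨B, hB, hBv⟩ := tryPropose_of_some (leader := leader)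
        (s := { E.state jL (leader w) with timer := true })
        (b := E.batch (E.state jL (leader w)).view) (congrArg leader hv) hd
      exact ⟨B, hB, hBv.trans hv⟩
    · exact ⟨X, (E.mono (by omega) hLF).2.2.2.2 (hvoted _ hL k X hX hXw).2.2, hXw⟩
  obtain ⟨i, hi, hno, B, hB, hBw⟩ := exists_step
    (p := fun i => ∃ B ∈ (E.state i (leader w)).proposed, B.view = w)
    (by simp [E.state_zero, LocalState.initial]) hprop
  have hBnot : B ∉ (E.state i (leader w)).proposed := fun h => hno ⟨B, h, hBw⟩
  obtain ⟨s, d, hbest, -, hsv, hsin, htimer, hBeq⟩ := exists_best_of_proposed hLF hBnot hB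
  have hsw : s.view = w := by
    rw [hBeq] at hBw
    exact hBw
  have hti : t₀ + (Tf + Δ + 1) ≤ E.time i := by
    obtain ⟨j, hj, haj, hinj⟩ := E.exists_timer_input (i + 1) hLF htimer
    rw [← hsv, hsw] at hinj
    have h1 := hps.timer_accurate iL _ hL w hiL j haj hinj
    have h2 := E.time_mono (Nat.lt_succ_iff.1 hj)
    rw [hwait] at h1
    linarith
  have hti' : E.time i ≤ t₀ + Tf + (Tf + Δ + 1) := by
    have := E.time_mono (Nat.lt_succ_iff.1 hi)
    linarith
  obtain ⟨hBs, hBne⟩ := sound_of_mem_proposed hLF hB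
  have hBsig : E.Signed (i + 1) B := (E.authInv (i + 1) hLF).proposed B hB
  have hrep : ∀ q ∈ E.honest, ∃ x ∈ B.reports, x.1 = q := by
    have h1 := hgood s hsw fun q hq => by
      obtain ⟨m, hm, h⟩ := hinbox i (by linarith) q hq
      exact ⟨m, hsin ▸ (E.mono_succ i hLF).2.2.2.1 hm, h⟩
    rw [hBeq]
    simpa only [Block.reports, hbest.1.reports_eq] using h1
  have hvote : ∀ q ∈ E.honest, ∃ j, (E.state j q).view ≤ w ∧
      B ∈ (E.state (j + 1) q).votes := by
    intro q hq
    have hqF := E.honest_subset hq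
    obtain ⟨iq, hiq, hq0, hq1⟩ := henter q hq
    obtain ⟨j, hij, haj, hinj, htj⟩ := hps.proposal i _ hL B hBnot hB q hq
    rw [max_eq_left (by linarith)] at htj
    have hiqj : iq < j := by
      refine lt_trans ?_ hij
      by_contra! h
      have := E.time_mono h
      linarith
    rcases hstay q hq iq hiq j hiqj (by linarith) with hv | ⟨k, hk, hv, X, hX, hXw⟩
    · exact ⟨j, hv.le, E.mem_votes_of_delivered hqF haj hinj hBs hBne (hBsig.mono hij)
        (hBw.symm ▸ hLF) (hBw.trans hv.symm)⟩
    · obtain ⟨hXs, hXne, -⟩ := hvoted q hq k X hX hXw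
      have : X = B := (hXs.mono (le_max_left (k + 1) (i + 1))).eq_of_view_eq
        (hBsig.mono (le_max_right (k + 1) (i + 1))) hXne hBne (hXw.trans hBw.symm)
        (hBw.symm ▸ hLF)
      exact ⟨k, hv.le, this ▸ hX⟩
  have hvote' : ∀ q : Fin n, ∃ j, q ∈ E.honest → B ∈ (E.state (j + 1) q).votes := by
    intro q
    by_cases hq : q ∈ E.honest
    · obtain ⟨j, -, h⟩ := hvote q hq
      exact ⟨j, fun _ => h⟩
    · exact ⟨0, fun h => absurd h hq⟩
  choose j hj using hvote'
  let T := max (i + 1) (Finset.univ.sup fun q => j q + 1)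
  refine ⟨B, T, hBw, ?_, (E.mono (le_max_left _ _) hLF).2.2.2.2 hB, hrep, ?_, ?_, hvote⟩
  · rw [hBeq, ← hsw]
    rfl
  · intro c hc hcw hcq
    rw [hBeq] at hc hcq ⊢
    cases hc with
    | refl => exact absurd hcw (by simp [Block.view, hsw])
    | step _ _ _ _ _ _ hc => exact hbest.view_le hc hcq
  · intro q hq
    refine (E.mono (le_trans ?_ (le_max_right _ _)) (E.honest_subset hq)).2.1 (hj q hq)
    exact Finset.le_sup (f := fun q => j q + 1) (Finset.mem_univ q)

theorem GoodView.mono {w i j : ℕ} {B : Block n Tx} (h : E.GoodView w B i) (hij : i ≤ j)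
    (hL : leader w ∈ E.honest) : E.GoodView w B j :=
  { h with
    proposed := (E.mono hij (E.honest_subset hL)).2.2.2.2 h.proposed
    voted := fun r hr => (E.mono hij (E.honest_subset hr)).2.1 (h.voted r hr) }

theorem GoodView.sound {w i : ℕ} {B : Block n Tx} (h : E.GoodView w B i)
    (hL : leader w ∈ E.honest) : Sound f ExVal B ∧ B ≠ genesis ∧ E.Signed i B :=
  have hs := sound_of_mem_proposed (E.honest_subset hL) h.proposed
  ⟨hs.1, hs.2, (E.authInv i (E.honest_subset hL)).proposed B h.proposed⟩

/-- All later blocks extend the block of a good view. -/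
theorem GoodView.ancestor (hf : 3 * f < n) {w i : ℕ} {B D : Block n Tx} (h : E.GoodView w B i)
    (hL : leader w ∈ E.honest) (hD : Sound f ExVal D) (hD' : E.Signed i D)
    (hle : w ≤ D.view) : Ancestor B D := by
  obtain ⟨hBs, hne, hB⟩ := h.sound hL
  have heq : ∀ A : Block n Tx, Sound f ExVal A → E.Signed i A → A.view = B.view →
      Ancestor B A := by
    intro A hA hA' hv
    have hAne : A ≠ genesis := by
      rintro rfl
      exact hne (hBs.eq_genesis hv.symm)
    rw [hA'.eq_of_view_eq hB hAne hne hv (h.view_eq.symm ▸ E.honest_subset hL)]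
    exact .refl _
  rcases hle.lt_or_eq with hlt | hv
  · exact ancestor_of_view_lt hf E.honest_card (fun r hr _ => h.voted r hr)
      (fun A hA hA' hv _ => heq A hA hA' hv) D hD hD' (h.view_eq.symm ▸ hlt)
  · exact heq D hD hD' (hv.symm.trans h.view_eq.symm)

/-- The block of a good view reports a quorum of votes for the block of an earlier one. -/
theorem GoodView.voters_card {w w' i : ℕ} {B B' : Block n Tx} (h : E.GoodView w B i)
    (h' : E.GoodView w' B' i) (hL' : leader w' ∈ E.honest) (hlt : w < w') :
    n - f ≤ (voters B'.reports B).card := by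
  refine E.honest_card.trans (Finset.card_le_card fun r hr => ?_)
  obtain ⟨x, hx, rfl⟩ := h'.reports r hr
  refine mem_voters.2 ⟨x, hx, rfl, ?_⟩
  refine ((h'.sound hL').2.2.mem_report hx (E.honest_subset hr)).2 ⟨h.voted _ hr, ?_⟩
  rw [h.view_eq, h'.view_eq]
  exact hlt

/-- The certificate in the block of a good view is not older than any earlier good view. -/
theorem GoodView.le_certified (hf : 3 * f < n) {w w' i : ℕ} {B B' : Block n Tx}
    (h : E.GoodView w B i) (h' : E.GoodView w' B' i) (hL : leader w ∈ E.honest)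
    (hL' : leader w' ∈ E.honest) (hlt : w < w') : w ≤ B'.certified.view := by
  obtain ⟨hBs', -, hB'⟩ := h'.sound hL'
  have := h'.certified B (h.ancestor hf hL hBs' hB' (h'.view_eq.symm ▸ hlt.le))
    (h.view_eq.symm ▸ hlt) (h.voters_card h' hL' hlt)
  rwa [h.view_eq] at this

theorem committedBy_of_honestTriple (hf : 3 * f < n) {GST : ℝ}
    (hps : E.PartiallySynchronous GST Δ) {v v' v'' : ℕ} (h : E.HonestTriple GST Tf v v' v'') :
    (∃ B, E.Proposed v B ∧ B.batch = some (E.batch v)) ∧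
      ∀ B, E.Proposed v B → E.CommittedBy v'' B := by
  obtain ⟨B₁, i₁, h₁⟩ := exists_goodView hps h.honest₁ h.sync₁
  obtain ⟨B₂, i₂, h₂⟩ := exists_goodView hps h.honest₂ h.sync₂
  obtain ⟨B₃, i₃, h₃⟩ := exists_goodView hps h.honest₃ h.sync₃
  refine ⟨⟨B₁, ⟨h₁.view_eq, i₁, h₁.proposed⟩, h₁.batch_eq⟩, ?_⟩
  rintro B ⟨hBv, k, hB⟩
  have hL₁ := E.honest_subset h.honest₁
  obtain rfl : B = B₁ := (E.localInv (max k i₁) hL₁).proposed_unique _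
    ((E.mono (le_max_left _ _) hL₁).2.2.2.2 hB) _
    ((E.mono (le_max_right _ _) hL₁).2.2.2.2 h₁.proposed) (hBv.trans h₁.view_eq.symm)
  let T := max i₁ (max i₂ i₃)
  replace h₁ : E.GoodView v B T := h₁.mono (le_max_left _ _) h.honest₁
  replace h₂ : E.GoodView v' B₂ T :=
    h₂.mono ((le_max_left _ _).trans (le_max_right _ _)) h.honest₂
  replace h₃ : E.GoodView v'' B₃ T :=
    h₃.mono ((le_max_right _ _).trans (le_max_right _ _)) h.honest₃
  obtain ⟨hs₂, hne₂, hB₂⟩ := h₂.sound h.honest₂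
  obtain ⟨hs₃, hne₃, hB₃⟩ := h₃.sound h.honest₃
  have hlock : Locks f B₂ B := by
    refine ⟨h₁.voters_card h₂ h.honest₂ h.lt₁, fun x hx X hX hle => ?_⟩
    have hpart : Relation.ReflTransGen Part X B₂ := .single (part_of_mem_reports hx hX)
    exact h₁.ancestor hf h.honest₁ (hs₂.of_parts hpart) (hB₂.of_parts hpart) (hBv ▸ hle)
  have hcert : Ancestor B₂ B₃.certified :=
    h₂.ancestor hf h.honest₂ (hs₃.of_parts (parts_certified _))
      (hB₃.of_parts (parts_certified _)) (h₂.le_certified hf h₃ h.honest₂ h.honest₃ h.lt₂)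
  have hpart := (parts_certified B₃.certified).trans (parts_certified B₃)
  have hcert' : Ancestor B B₃.certified.certified := by
    refine h₁.ancestor hf h.honest₁ (hs₃.of_parts hpart) (hB₃.of_parts hpart) ?_
    exact (h₁.le_certified hf h₂ h.honest₁ h.honest₂ h.lt₁).trans
      ((hs₃.of_parts (parts_certified _)).certified_view_mono hcert)
  obtain ⟨k', hk', hanc⟩ := exists_protocol_commitRule (hΔ := hΔ) (hTf := hTf) hs₃
    ⟨hcert', B₂, h₂.voters_card h₃ h.honest₃ h.lt₂, hlock⟩
  intro r hr
  obtain ⟨j, hj, hvote⟩ := h₃.voted_in_view r hr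
  exact ⟨j, hj, B₃, hvote, k', hk', hanc⟩

end Main

end Execution

end CLSO

theorem theorem2 {Tx : Type*} (n f : ℕ) (hf : 3 * f < n) (leader : ℕ → Fin n)
    (ExVal : Tx → Prop) (Δ Tf : ℝ) (hΔ : 0 < Δ) (hTf : 0 ≤ Tf) :
    ∃ P : CLSO.Protocol n f Tx,
      P.Safe leader ExVal ∧
      P.ExternallyValid leader ExVal ∧
      P.SlashesOnlyDeviating leader ExVal ∧
      P.OmissionGapTolerant leader ExVal Δ Tf ∧
      P.CommitsOrSlashes leader ExVal Δ Tf := by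
  refine ⟨CLSO.protocol n f ExVal Δ Tf hΔ hTf, CLSO.protocol_safe hf,
    CLSO.protocol_externallyValid, CLSO.protocol_slashesOnlyDeviating, ?_, ?_⟩
  · intro E GST _ hps v v' v'' h
    exact CLSO.Execution.committedBy_of_honestTriple hf hps h
  · intro E GST hps v v' v'' h
    have hc := CLSO.Execution.committedBy_of_honestTriple hf hps h
    exact ⟨hc.1, fun B hB => .inl (hc.2 B hB)⟩
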